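/- Let $G=\mathbb{F}_5^n$ (with $n\ge 0$ an integer). Functions $\phi_1,\dots,\phi_k:G\to\mathbb{F}_5$ generate a $\sigma$-algebra on $G$ whose atoms are the non-empty sets $\{x:\phi_1(x)=c_1,\dots,\phi_k(x)=c_k\}$; a $\sigma$-algebra $\mathcal{B}'$ refines $\mathcal{B}$ if every atom of $\mathcal{B}'$ is contained in an atom of $\mathcal{B}$. For $f:G\to\mathbb{R}$, $\mathbb{E}(f|\mathcal{B})(x)$ denotes the average of $f$ over the atom of $\mathcal{B}$ containing $x$. A quadratic factor of complexity $(d_1,d_2)$ is a pair $(\mathcal{B}_1,\mathcal{B}_2)$ for which there are vectors $r_1,\dots,r_{d_1}\in G$ and symmetric $n\times n$ matrices $M_1,\dots,M_{d_2}$ over $\mathbb{F}_5$ such that $\mathcal{B}_1$ is generated by the functions $r_j^Tx$ and $\mathcal{B}_2$ by the functions $r_j^Tx$ and $x^TM_jx$; it has complexity at most $(d_1,d_2)$ if it has complexity $(e_1,e_2)$ for some $e_1\le d_1$, $e_2\le d_2$. The pair $(\mathcal{B}_1,\mathcal{B}_2)$ refines $(\mathcal{B}_1',\mathcal{B}_2')$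 if $\mathcal{B}_i$ refines $\mathcal{B}_i'$ for $i=1,2$. The Gowers $U^3$-norm $\|f\|_{U^3}\ge 0$ of $f:G\to\mathbb{R}$ is given by \[ \|f\|_{U^3}^8=\mathbb{E}_{x,h_1,h_2,h_3\in G}\,f(x)f(x+h_1)f(x+h_2)f(x+h_3)f(x+h_1+h_2)f(x+h_1+h_3)f(x+h_2+h_3)f(x+h_1+h_2+h_3), \] where $\mathbb{E}$ denotes the average. **Quadratic Koopman–von Neumann decomposition.** For every $\delta>0$ there is a constant $C=C(\delta)$, depending only on $\delta$, such that the following holds for all $n,d_1^{(0)},d_2^{(0)}\ge 0$. Let $(\mathcal{B}_1^{(0)},\mathcal{B}_2^{(0)})$ be a quadratic factor on $\mathbb{F}_5^n$ of complexity at most $(d_1^{(0)},d_2^{(0)})$ and let $f:\mathbb{F}_5^n\to[-1,1]$ be a function. Then there is a quadratic factor $(\mathcal{B}_1,\mathcal{B}_2)$ of complexity at most $(d_1^{(0)}+C,\,d_2^{(0)}+C)$ which refines $(\mathcal{B}_1^{(0)},\mathcal{B}_2^{(0)})$, and such that $f=f_1+f_2$, where $f_1=\mathbb{E}(f|\mathcal{B}_2)$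 and $\|f_2\|_{U^3}\le\delta$. -/

import Mathlib

open scoped BigOperators Matrix

/-- The vector space `𝔽₅ⁿ`. -/
abbrev F5Vec (n : ℕ) : Type := Fin n → ZMod 5

/-- The factor described by functions `φ i : 𝔽₅ⁿ → 𝔽₅`: the σ-algebra generated by them, whose
members are the unions of the sets `{x | ∀ i, φ i x = c i}`. -/
def factorOf {n : ℕ} {ι : Type} (φ : ι → F5Vec n → ZMod 5) : MeasurableSpace (F5Vec n) :=
  MeasurableSpace.comap (fun x i => φ i x) ⊤

/-- `B(x)`, the atom of `B` which contains `x`. -/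
def atomOf {n : ℕ} (B : MeasurableSpace (F5Vec n)) (x : F5Vec n) : Set (F5Vec n) :=
  @measurableAtom (F5Vec n) B x

theorem atomOf_factorOf {n : ℕ} {ι : Type} (φ : ι → F5Vec n → ZMod 5) (x : F5Vec n) :
    atomOf (factorOf φ) x = {y | ∀ i, φ i y = φ i x} := by
  ext y
  simp only [atomOf, measurableAtom, Set.mem_iInter, Set.mem_setOf_eq]
  constructor
  · intro h i
    exact h {z | φ i z = φ i x} rfl ⟨{c | c i = φ i x}, trivial, rfl⟩
  · rintro h s hx ⟨t, -, rfl⟩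
    have : (fun i => φ i y) = (fun i => φ i x) := funext h
    simpa [this] using hx

/-- `B'` refines `B`: every atom of `B'` is contained in an atom of `B`. -/
def RefinesFactor {n : ℕ} (B' B : MeasurableSpace (F5Vec n)) : Prop :=
  ∀ x, ∃ z, atomOf B' x ⊆ atomOf B z

open Classical in
/-- The conditional expectation `𝔼(f|B)`: its value at `x` is the average of `f` over the atom of
`B` which contains `x`. -/
noncomputable def condAvg {n : ℕ} (f : F5Vec n → ℝ) (B : MeasurableSpace (F5Vec n)) :
    F5Vec n → ℝ :=
  fun x => 𝔼 y ∈ Finset.univ.filter (fun y => y ∈ atomOf B x), f y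

/-- The linear factor generated by the functions `rⱼᵀ x`. -/
def linearFactor {n d₁ : ℕ} (r : Fin d₁ → F5Vec n) : MeasurableSpace (F5Vec n) :=
  factorOf (fun (j : Fin d₁) x => r j ⬝ᵥ x)

/-- The σ-algebra generated by the functions `rⱼᵀ x` and `xᵀ Mⱼ x`. -/
def linQuadFactor {n d₁ d₂ : ℕ} (r : Fin d₁ → F5Vec n)
    (M : Fin d₂ → Matrix (Fin n) (Fin n) (ZMod 5)) : MeasurableSpace (F5Vec n) :=
  factorOf (Sum.elim (fun (j : Fin d₁) x => r j ⬝ᵥ x) (fun (j : Fin d₂) x => x ⬝ᵥ (M j *ᵥ x)))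

/-- `(B₁, B₂)` is a (homogeneous) quadratic factor of complexity `(d₁, d₂)`. -/
def IsQuadraticFactor {n : ℕ} (B₁ B₂ : MeasurableSpace (F5Vec n)) (d₁ d₂ : ℕ) : Prop :=
  ∃ (r : Fin d₁ → F5Vec n) (M : Fin d₂ → Matrix (Fin n) (Fin n) (ZMod 5)),
    (∀ j, (M j).IsSymm) ∧ B₁ = linearFactor r ∧ B₂ = linQuadFactor r M

/-- `(B₁, B₂)` is a quadratic factor of complexity at most `(d₁, d₂)`. -/
def IsQuadraticFactorLE {n : ℕ} (B₁ B₂ : MeasurableSpace (F5Vec n)) (d₁ d₂ : ℕ) : Prop :=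
  ∃ e₁ e₂ : ℕ, e₁ ≤ d₁ ∧ e₂ ≤ d₂ ∧ IsQuadraticFactor B₁ B₂ e₁ e₂

/-- The eighth power of the Gowers `U³`-norm. -/
noncomputable def gowersU3Pow {n : ℕ} (f : F5Vec n → ℝ) : ℝ :=
  𝔼 x : F5Vec n, 𝔼 h₁ : F5Vec n, 𝔼 h₂ : F5Vec n, 𝔼 h₃ : F5Vec n,
    f x * f (x + h₁) * f (x + h₂) * f (x + h₃) * f (x + h₁ + h₂) * f (x + h₁ + h₃) *
      f (x + h₂ + h₃) * f (x + h₁ + h₂ + h₃)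

theorem gowersU3Pow_nonneg {n : ℕ} (f : F5Vec n → ℝ) : 0 ≤ gowersU3Pow f := by
  have key : gowersU3Pow f = 𝔼 h₁ : F5Vec n, 𝔼 h₂ : F5Vec n,
      (𝔼 x : F5Vec n, f x * f (x + h₁) * f (x + h₂) * f (x + h₁ + h₂)) ^ 2 := by
    unfold gowersU3Pow
    rw [Finset.expect_comm]
    refine Finset.expect_congr rfl fun h₁ _ => ?_
    rw [Finset.expect_comm]
    refine Finset.expect_congr rfl fun h₂ _ => ?_
    rw [sq, Finset.expect_mul_expect]
    refine Finset.expect_congr rfl fun x _ => ?_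
    refine Fintype.expect_equiv (Equiv.addLeft x) _ _ fun h₃ => ?_
    simp only [Equiv.coe_addLeft]
    rw [add_right_comm x h₁ h₃, add_right_comm x h₂ h₃, add_right_comm (x + h₁) h₂ h₃,
      add_right_comm x h₁ h₃]
    ring
  rw [key]
  exact Finset.expect_nonneg fun _ _ => Finset.expect_nonneg fun _ _ => sq_nonneg _

/-- The Gowers `U³`-norm of a real function on `𝔽₅ⁿ`. -/
noncomputable def gowersU3 {n : ℕ} (f : F5Vec n → ℝ) : ℝ :=
  gowersU3Pow f ^ (1 / 8 : ℝ)

/-! The proof is an energy increment driven by an inverse theorem for the `U³`-norm. If `f -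
𝔼(f|B₂)` has `U³`-norm above `δ`, then `gowersU3_inverse` makes it correlate with a bounded function
of `K` linear forms and one quadratic form, where `K` depends only on `δ`. Adjoining these forms to
the factor raises the energy `𝔼 𝔼(f|B₂)²` by at least `c²` (`energy_increment`). The energy lies in
`[0, 1]`, so about `1 / c²` rounds suffice, whatever the initial factor.

For the inverse theorem, large `U³`-norm means that for many `h` the derivative `f(x) f(x + h)` has
a large Fourier coefficient, at some `ξ h`. Two applications of Cauchy–Schwarz show that the graph
of `ξ` has large additive energy (`energy_graph_ge`). The Balog–Szemerédi–Gowers and Freiman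
theorems then give `ξ h = M h + b` for a positive proportion of `h`.

Write `M = S + A` with `S` symmetric and `A` antisymmetric. The part `S` is integrated into the
quadratic phase `e(xᵀSx / 2)`, which leaves a `U²`-type average of `u = f · e(xᵀSx / 2)` twisted by
`A` (`twistedAverage`). Its size forces the image of `A` to be bounded
(`norm_twistedAverage_sq_le`). On the level sets of `A` the twist becomes linear, so `u` correlates
with a character restricted to such a level set (`exists_structured_coeff`). -/

/-! ### Fourier analysis on `𝔽₅ⁿ`. -/

/-- The standard additive character of `𝔽₅`. -/
noncomputable def e5 : AddChar (ZMod 5) ℂ := ZMod.stdAddChar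

theorem norm_e5 (t : ZMod 5) : ‖e5 t‖ = 1 := AddChar.norm_apply e5 t

theorem conj_e5 (t : ZMod 5) : (starRingEnd ℂ) (e5 t) = e5 (-t) :=
  (AddChar.map_neg_eq_conj e5 t).symm

theorem e5_add (s t : ZMod 5) : e5 (s + t) = e5 s * e5 t := AddChar.map_add_eq_mul e5 s t

theorem e5_eq_one_iff {t : ZMod 5} : e5 t = 1 ↔ t = 0 := by
  constructor
  · intro h
    exact ZMod.injective_stdAddChar (by simpa [e5] using h)
  · rintro rfl
    exact AddChar.map_zero_eq_one e5

/-- The character `x ↦ e(v · x)` of `𝔽₅ⁿ`. -/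
noncomputable def dotChar {n : ℕ} (v : F5Vec n) : AddChar (F5Vec n) ℂ where
  toFun x := e5 (v ⬝ᵥ x)
  map_zero_eq_one' := by simp
  map_add_eq_mul' x y := by rw [dotProduct_add, e5_add]

theorem dotChar_eq_zero_iff {n : ℕ} {v : F5Vec n} : dotChar v = 0 ↔ v = 0 := by
  constructor
  · intro h
    ext i
    have h1 : dotChar v (Pi.single i 1) = 1 := by rw [h]; rfl
    have h2 : e5 (v ⬝ᵥ Pi.single i 1) = 1 := h1
    rw [e5_eq_one_iff, dotProduct_single_one] at h2
    exact h2
  · rintro rfl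
    ext x
    show e5 ((0 : F5Vec n) ⬝ᵥ x) = 1
    simp

theorem expect_e5_dot {n : ℕ} (v : F5Vec n) :
    𝔼 x, e5 (v ⬝ᵥ x) = if v = 0 then 1 else 0 := by
  classical
  have h := AddChar.expect_eq_ite (dotChar v)
  simp only [dotChar_eq_zero_iff] at h
  exact h

theorem expect_e5_dot' {n : ℕ} (v : F5Vec n) :
    𝔼 x, e5 (x ⬝ᵥ v) = if v = 0 then 1 else 0 := by
  simp_rw [dotProduct_comm _ v]
  exact expect_e5_dot v

theorem sum_e5_dot {n : ℕ} (v : F5Vec n) :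
    ∑ x, e5 (x ⬝ᵥ v) = if v = 0 then (Fintype.card (F5Vec n) : ℂ) else 0 := by
  rw [← Fintype.card_mul_expect, expect_e5_dot']
  simp

theorem expect_card_ite {n : ℕ} (f : F5Vec n → ℂ) (t : F5Vec n) :
    𝔼 x, f x * (if x - t = 0 then (Fintype.card (F5Vec n) : ℂ) else 0) = f t := by
  have h : (Fintype.card (F5Vec n) : ℂ) ≠ 0 := by exact_mod_cast Fintype.card_ne_zero
  rw [Fintype.expect_eq_sum_div_card]
  simp only [sub_eq_zero, mul_ite, mul_zero, Finset.sum_ite_eq', Finset.mem_univ, if_true]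
  field_simp

theorem normSq_expect {ι : Type*} [Fintype ι] (g : ι → ℂ) :
    ((‖𝔼 x, g x‖ ^ 2 : ℝ) : ℂ) = 𝔼 x, 𝔼 y, g x * (starRingEnd ℂ) (g y) := by
  rw [Complex.ofReal_pow, ← Complex.mul_conj', map_expect, Finset.expect_mul_expect]

theorem expect_shift {n : ℕ} {M : Type*} [AddCommMonoid M] [Module ℚ≥0 M] (x : F5Vec n)
    (f : F5Vec n → M) : 𝔼 y, f y = 𝔼 k, f (x + k) :=
  (Fintype.expect_equiv (Equiv.addLeft x) _ _ fun _ => rfl).symm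

theorem normSq_expect_shift {n : ℕ} (g : F5Vec n → ℂ) :
    ((‖𝔼 x, g x‖ ^ 2 : ℝ) : ℂ) = 𝔼 x, 𝔼 k, g x * (starRingEnd ℂ) (g (x + k)) := by
  rw [normSq_expect]
  exact Finset.expect_congr rfl fun x _ => expect_shift x _

theorem ofReal_expect' {ι : Type*} [Fintype ι] (g : ι → ℝ) :
    ((𝔼 x, g x : ℝ) : ℂ) = 𝔼 x, (g x : ℂ) :=
  RCLike.ofReal_expect (K := ℂ) _ _

theorem expect_sq_le {ι : Type*} [Fintype ι] [Nonempty ι] (g : ι → ℝ) :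
    (𝔼 x, g x) ^ 2 ≤ 𝔼 x, g x ^ 2 := by
  have := Finset.expect_mul_sq_le_sq_mul_sq (R := ℝ) Finset.univ g (fun _ => 1)
  simpa using this

theorem norm_expect_le_one {ι : Type*} [Fintype ι] [Nonempty ι] {g : ι → ℂ}
    (hg : ∀ x, ‖g x‖ ≤ 1) : ‖𝔼 x, g x‖ ≤ 1 :=
  (RCLike.norm_expect_le (K := ℂ)).trans (Finset.expect_le Finset.univ_nonempty fun x _ => hg x)

/-- The Fourier coefficient `𝔼 u(x) e(x · ξ)`. -/
noncomputable def fourierCoeff5 {n : ℕ} (u : F5Vec n → ℂ) (ξ : F5Vec n) : ℂ :=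
  𝔼 x, u x * e5 (ξ ⬝ᵥ x)

theorem fourierCoeff5_inversion {n : ℕ} (u : F5Vec n → ℂ) (t : F5Vec n) :
    u t = ∑ ξ, fourierCoeff5 u ξ * e5 (-(ξ ⬝ᵥ t)) := by
  simp only [fourierCoeff5, Finset.expect_mul]
  rw [← Finset.expect_sum_comm]
  conv_lhs => rw [← expect_card_ite u t]
  refine Finset.expect_congr rfl fun x _ => ?_
  rw [← sum_e5_dot, Finset.mul_sum]
  refine Finset.sum_congr rfl fun ξ _ => ?_
  rw [mul_assoc, ← e5_add, dotProduct_sub, sub_eq_add_neg]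

theorem sum_norm_fourierCoeff5_sq {n : ℕ} (u : F5Vec n → ℂ) :
    ∑ ξ, ‖fourierCoeff5 u ξ‖ ^ 2 = 𝔼 x, ‖u x‖ ^ 2 := by
  apply Complex.ofReal_injective
  rw [Complex.ofReal_sum]
  simp only [fourierCoeff5, normSq_expect]
  rw [← Finset.expect_sum_comm]
  rw [ofReal_expect']
  rw [Finset.expect_congr rfl]
  intro y _
  rw [← Finset.expect_sum_comm]
  have : ((‖u y‖ ^ 2 : ℝ) : ℂ) = u y * (starRingEnd ℂ) (u y) := by
    rw [Complex.mul_conj', Complex.ofReal_pow]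
  refine Eq.trans ?_ this.symm
  rw [← expect_card_ite (fun z => u y * (starRingEnd ℂ) (u z)) y]
  refine Finset.expect_congr rfl fun x _ => ?_
  have h0 : (if x - y = 0 then (Fintype.card (F5Vec n) : ℂ) else 0) =
      ∑ ξ, e5 (ξ ⬝ᵥ (y - x)) := by
    rw [sum_e5_dot]
    exact if_congr (by rw [sub_eq_zero, sub_eq_zero, eq_comm]) rfl rfl
  rw [h0, Finset.mul_sum]
  refine Finset.sum_congr rfl fun ξ _ => ?_
  rw [map_mul, conj_e5, dotProduct_sub, sub_eq_add_neg, e5_add]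
  ring

theorem expect_conv_eq_sum_fourierCoeff5 {n : ℕ} (u₁ u₂ u₃ u₄ : F5Vec n → ℂ) :
    𝔼 a, 𝔼 b, 𝔼 c, u₁ a * u₂ b * u₃ c * u₄ (b + c - a) =
      ∑ ξ, fourierCoeff5 u₁ ξ * fourierCoeff5 u₂ (-ξ) * fourierCoeff5 u₃ (-ξ) *
        fourierCoeff5 u₄ ξ := by
  have h : ∀ a b c, u₁ a * u₂ b * u₃ c * u₄ (b + c - a) = ∑ ξ,
      fourierCoeff5 u₄ ξ * ((u₁ a * e5 (ξ ⬝ᵥ a)) *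
        ((u₂ b * e5 (-ξ ⬝ᵥ b)) * (u₃ c * e5 (-ξ ⬝ᵥ c)))) := by
    intro a b c
    rw [fourierCoeff5_inversion u₄ (b + c - a), Finset.mul_sum]
    refine Finset.sum_congr rfl fun ξ _ => ?_
    have : -(ξ ⬝ᵥ (b + c - a)) = ξ ⬝ᵥ a + (-ξ ⬝ᵥ b + -ξ ⬝ᵥ c) := by
      simp only [dotProduct_sub, dotProduct_add, neg_dotProduct]; ring
    rw [this, e5_add, e5_add]
    ring
  simp only [h, Finset.expect_sum_comm, ← Finset.mul_expect, ← Finset.expect_mul]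
  refine Finset.sum_congr rfl fun ξ _ => ?_
  simp only [fourierCoeff5]
  ring

/-- In the Fourier expansion of the average, take out the largest coefficient of `u₁` and bound that
of `u₄` by `1`. Parseval for `u₂` and `u₃` with AM–GM bounds the rest by `1`. -/
theorem exists_le_norm_fourierCoeff5 {n : ℕ} {u₁ u₂ u₃ u₄ : F5Vec n → ℂ}
    (h₂ : ∀ x, ‖u₂ x‖ ≤ 1) (h₃ : ∀ x, ‖u₃ x‖ ≤ 1) (h₄ : ∀ x, ‖u₄ x‖ ≤ 1) :
    ∃ ξ, ‖𝔼 a, 𝔼 b, 𝔼 c, u₁ a * u₂ b * u₃ c * u₄ (b + c - a)‖ ≤ ‖fourierCoeff5 u₁ ξ‖ := by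
  obtain ⟨ξ₀, hξ₀⟩ := Finite.exists_max fun ξ => ‖fourierCoeff5 u₁ ξ‖
  refine ⟨ξ₀, ?_⟩
  have key : ∀ u : F5Vec n → ℂ, (∀ x, ‖u x‖ ≤ 1) → ∑ ξ, ‖fourierCoeff5 u (-ξ)‖ ^ 2 ≤ 1 := by
    intro u hu
    have : ∑ ξ, ‖fourierCoeff5 u (-ξ)‖ ^ 2 = ∑ ξ, ‖fourierCoeff5 u ξ‖ ^ 2 :=
      Fintype.sum_equiv (Equiv.neg _) _ _ fun _ => rfl
    rw [this, sum_norm_fourierCoeff5_sq]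
    exact Finset.expect_le Finset.univ_nonempty fun x _ => pow_le_one₀ (norm_nonneg _) (hu x)
  have h4 : ∀ ξ, ‖fourierCoeff5 u₄ ξ‖ ≤ 1 := fun ξ =>
    norm_expect_le_one fun x => by rw [norm_mul, norm_e5, mul_one]; exact h₄ x
  rw [expect_conv_eq_sum_fourierCoeff5]
  calc _ ≤ ∑ ξ, ‖fourierCoeff5 u₁ ξ₀‖ *
        ((‖fourierCoeff5 u₂ (-ξ)‖ ^ 2 + ‖fourierCoeff5 u₃ (-ξ)‖ ^ 2) / 2) := by
        refine norm_sum_le_of_le _ fun ξ _ => ?_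
        rw [norm_mul, norm_mul, norm_mul, mul_assoc, mul_assoc]
        have := hξ₀ ξ
        gcongr
        calc _ ≤ ‖fourierCoeff5 u₂ (-ξ)‖ * (‖fourierCoeff5 u₃ (-ξ)‖ * 1) := by
                gcongr; exact h4 ξ
          _ ≤ _ := by nlinarith [sq_nonneg (‖fourierCoeff5 u₂ (-ξ)‖ - ‖fourierCoeff5 u₃ (-ξ)‖)]
    _ = ‖fourierCoeff5 u₁ ξ₀‖ * ((∑ ξ, ‖fourierCoeff5 u₂ (-ξ)‖ ^ 2 +
          ∑ ξ, ‖fourierCoeff5 u₃ (-ξ)‖ ^ 2) / 2) := by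
        rw [← Finset.mul_sum, ← Finset.sum_div, Finset.sum_add_distrib]
    _ ≤ ‖fourierCoeff5 u₁ ξ₀‖ * 1 := by
        gcongr
        linarith [key u₂ h₂, key u₃ h₃]
    _ = _ := mul_one _

/-! ### The Balog–Szemerédi–Gowers theorem. -/

section AdditiveCombinatorics

open Finset
open scoped Pointwise

variable {G : Type*} [AddCommGroup G] [DecidableEq G]

/-- The number of representations of `x` as a difference of two elements of `A`. -/
def diffRep (A : Finset G) (x : G) : ℕ := #{p ∈ A ×ˢ A | p.1 - p.2 = x}

theorem card_filter_sub_mem (A : Finset G) (x : G) :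
    #{a ∈ A | a - x ∈ A} = diffRep A x := by
  refine card_nbij' (fun a => (a, a - x)) Prod.fst ?_ ?_ ?_ ?_
  · intro a ha
    simpa using ha
  · rintro ⟨p, q⟩ hp
    simp only [coe_filter, mem_product, Set.mem_ofPred_eq] at hp ⊢
    obtain ⟨⟨h1, h2⟩, rfl⟩ := hp
    simpa [h1] using h2
  · intro a _
    rfl
  · rintro ⟨p, q⟩ hp
    simp only [coe_filter, mem_product, Set.mem_ofPred_eq] at hp
    obtain ⟨-, rfl⟩ := hp
    simp

theorem card_filter_common_translates [Fintype G] (A : Finset G) (a b : G) :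
    #{x : G | a - x ∈ A ∧ b - x ∈ A} = diffRep A (a - b) := by
  refine card_nbij' (fun x => (a - x, b - x)) (fun p => a - p.1) ?_ ?_ ?_ ?_
  · intro x hx
    simpa using hx
  · rintro ⟨p, q⟩ hp
    simp only [coe_filter, mem_product, Set.mem_ofPred_eq] at hp
    obtain ⟨⟨h1, h2⟩, h3⟩ := hp
    have : b - (a - p) = q := by
      rw [sub_eq_iff_eq_add] at h3
      rw [h3]; abel
    simp [h1, h2, this]
  · intro a _
    simp
  · rintro ⟨p, q⟩ hp
    simp only [coe_filter, mem_product, Set.mem_ofPred_eq] at hp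
    obtain ⟨-, h3⟩ := hp
    have : b - (a - p) = q := by
      have : b = a - (p - q) := by rw [h3]; abel
      rw [this]; abel
    simp [this]

theorem sum_diffRep [Fintype G] (A : Finset G) : ∑ x, diffRep A x = #A ^ 2 := by
  have := sum_card_fiberwise_eq_card_filter (A ×ˢ A) univ fun p : G × G => p.1 - p.2
  simpa [diffRep, sq] using this

/-- Averaging over the sets `X x = A ∩ (A + x)`: a pair `(a, b)` lies in `X x` for exactly `diffRep
A (a - b)` values of `x`, so unpopular differences are rare in a typical `X x`. -/
theorem exists_small_bad_pairs [Fintype G] {A : Finset G} (hA : A.Nonempty) {κ : ℝ} (hκ : 0 < κ)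
    (h : κ * (#A : ℝ) ^ 3 ≤ ∑ x, (diffRep A x : ℝ) ^ 2) :
    ∃ X ⊆ A, X.Nonempty ∧ κ / 2 * #A ≤ #X ∧
      8 * (#{p ∈ X ×ˢ X | (diffRep A (p.1 - p.2) : ℝ) ≤ κ / 16 * #A} : ℝ) ≤ (#X : ℝ) ^ 2 := by
  classical
  set X : G → Finset G := fun x => {a ∈ A | a - x ∈ A} with hX
  have hcard : ∀ x, #(X x) = diffRep A x := card_filter_sub_mem A
  set bad : G × G → Prop := fun p => (diffRep A (p.1 - p.2) : ℝ) ≤ κ / 16 * #A with hbad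
  have hA0 : (0 : ℝ) < #A := by exact_mod_cast hA.card_pos
  have hB : ∑ x, (#{p ∈ X x ×ˢ X x | bad p} : ℝ) ≤ κ / 16 * (#A : ℝ) ^ 3 := by
    have h1 : ∀ x, (#{p ∈ X x ×ˢ X x | bad p} : ℝ) =
        ∑ p ∈ {p ∈ A ×ˢ A | bad p}, if p.1 - x ∈ A ∧ p.2 - x ∈ A then (1 : ℝ) else 0 := by
      intro x
      rw [← sum_filter, filter_filter, sum_const, nsmul_eq_mul, mul_one]
      congr 2
      ext p
      simp only [hX, mem_filter, mem_product]
      tauto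
    simp_rw [h1]
    rw [sum_comm]
    calc _ ≤ ∑ p ∈ {p ∈ A ×ˢ A | bad p}, κ / 16 * (#A : ℝ) := by
          refine sum_le_sum fun p hp => ?_
          rw [← sum_filter, sum_const, nsmul_eq_mul, mul_one, card_filter_common_translates]
          exact (mem_filter.1 hp).2
      _ ≤ ∑ p ∈ A ×ˢ A, κ / 16 * (#A : ℝ) :=
          sum_le_sum_of_subset_of_nonneg (filter_subset _ _) fun _ _ _ => by positivity
      _ = κ / 16 * (#A : ℝ) ^ 3 := by
          rw [sum_const, nsmul_eq_mul, card_product]; push_cast; ring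
  have hS : ∑ x, (diffRep A x : ℝ) = (#A : ℝ) ^ 2 := by exact_mod_cast sum_diffRep A
  obtain ⟨x, hx0, hx⟩ : ∃ x, 0 < diffRep A x ∧ κ / 2 * #A * (diffRep A x : ℝ) ≤
      (diffRep A x : ℝ) ^ 2 - 8 * (#{p ∈ X x ×ˢ X x | bad p} : ℝ) := by
    -- The sum over `x` of the right side is at least `(κ - 8κ/16) |A|³`, which equals the sum of
    -- the left side because `∑ diffRep A x = |A|²`.
    by_contra! hcon
    obtain ⟨y, hy⟩ : ∃ y, 0 < diffRep A y := by
      by_contra! h0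
      have : ∑ x, (diffRep A x : ℝ) = 0 :=
        sum_eq_zero fun x _ => by exact_mod_cast Nat.le_zero.1 (h0 x)
      rw [hS] at this
      exact absurd this (by positivity)
    have hlt : ∑ x, ((diffRep A x : ℝ) ^ 2 - 8 * (#{p ∈ X x ×ˢ X x | bad p} : ℝ)) <
        ∑ x, κ / 2 * #A * (diffRep A x : ℝ) := by
      refine sum_lt_sum (fun x _ => ?_) ⟨y, mem_univ _, hcon y hy⟩
      rcases Nat.eq_zero_or_pos (diffRep A x) with h0 | h0
      · rw [h0]
        have : (0 : ℝ) ≤ #{p ∈ X x ×ˢ X x | bad p} := Nat.cast_nonneg _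
        norm_num
      · exact (hcon x h0).le
    rw [sum_sub_distrib, ← mul_sum, ← mul_sum, hS] at hlt
    nlinarith
  have hm : (0 : ℝ) < diffRep A x := by exact_mod_cast hx0
  refine ⟨X x, filter_subset _ _, card_pos.1 (by rw [hcard]; exact hx0), ?_, ?_⟩
  · rw [hcard]
    have : (0 : ℝ) ≤ #{p ∈ X x ×ˢ X x | bad p} := Nat.cast_nonneg _
    nlinarith
  · rw [hcard]
    have : 0 ≤ κ / 2 * #A * (diffRep A x : ℝ) := by positivity
    linarith

/-- The Balog–Szemerédi–Gowers theorem. -/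
theorem balog_szemeredi_gowers [Fintype G] {A : Finset G} (hA : A.Nonempty) {κ : ℝ} (hκ : 0 < κ)
    (h : κ * (#A : ℝ) ^ 3 ≤ ∑ x, (diffRep A x : ℝ) ^ 2) :
    ∃ A' ⊆ A, A'.Nonempty ∧ κ / 4 * #A ≤ #A' ∧ (#(A' - A') : ℝ) ≤ 4096 / κ ^ 4 * #A' := by
  classical
  obtain ⟨X, hXA, hX0, hX, hbadX⟩ := exists_small_bad_pairs hA hκ h
  set bad : G → G → Prop := fun a b => (diffRep A (a - b) : ℝ) ≤ κ / 16 * #A with hbad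
  have hA0 : (0 : ℝ) < #A := by exact_mod_cast hA.card_pos
  have hX0' : (0 : ℝ) < #X := by exact_mod_cast hX0.card_pos
  -- By Markov this keeps half of `X`. Any two elements of `A'` are both joined by popular
  -- differences to at least half of the `c ∈ X`.
  set A' : Finset G := {a ∈ X | (#{b ∈ X | bad a b} : ℝ) ≤ #X / 4} with hA'
  have hA'X : A' ⊆ X := filter_subset _ _
  have hcardA' : (#X : ℝ) / 2 ≤ #A' := by
    have h1 : (#{p ∈ X ×ˢ X | bad p.1 p.2} : ℝ) = ∑ a ∈ X, (#{b ∈ X | bad a b} : ℝ) := by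
      rw [← Nat.cast_sum, card_filter, sum_product]
      simp only [card_filter]
    have h2 : ∑ a ∈ X \ A', (#X : ℝ) / 4 ≤ ∑ a ∈ X, (#{b ∈ X | bad a b} : ℝ) := by
      refine (sum_le_sum fun a ha => ?_).trans
        (sum_le_sum_of_subset_of_nonneg sdiff_subset fun _ _ _ => Nat.cast_nonneg _)
      simp only [hA', mem_sdiff, mem_filter, not_and, not_le] at ha
      exact (ha.2 ha.1).le
    rw [sum_const, nsmul_eq_mul, card_sdiff_of_subset hA'X, Nat.cast_sub (card_le_card hA'X),
      ← h1] at h2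
    have h3 : 8 * (#{p ∈ X ×ˢ X | bad p.1 p.2} : ℝ) ≤ (#X : ℝ) ^ 2 := hbadX
    nlinarith
  have hA'card : κ / 4 * #A ≤ #A' := by linarith
  have hA'pos : (0 : ℝ) < #A' := by linarith
  refine ⟨A', hA'X.trans hXA, card_pos.1 (by exact_mod_cast hA'pos), hA'card, ?_⟩
  set S := (A ×ˢ A) ×ˢ (A ×ˢ A) with hS
  set g : (G × G) × (G × G) → G := fun s => (s.1.1 - s.1.2) - (s.2.1 - s.2.2) with hg
  -- Each common neighbour `c` gives `a - b = (a - c) - (b - c)` with two popular differences. As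
  -- only `|A|⁴` quadruples exist, few values `d` can be represented so often.
  have hrep : ∀ d ∈ A' - A', (#X : ℝ) / 2 * (κ / 16 * #A) ^ 2 ≤ #{s ∈ S | g s = d} := by
    intro d hd
    obtain ⟨a, ha, b, hb, rfl⟩ := mem_sub.1 hd
    set C := {c ∈ X | ¬ bad a c ∧ ¬ bad b c} with hC
    have hCcard : (#X : ℝ) / 2 ≤ #C := by
      have h1 : X ⊆ C ∪ ({c ∈ X | bad a c} ∪ {c ∈ X | bad b c}) := by
        intro c hc
        simp only [hC, mem_union, mem_filter]
        tauto
      have h2 : (#X : ℝ) ≤ #C + (#{c ∈ X | bad a c} + #{c ∈ X | bad b c}) := by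
        exact_mod_cast (card_le_card h1).trans ((card_union_le _ _).trans
          (Nat.add_le_add_left (card_union_le _ _) _))
      have h3 := (mem_filter.1 ha).2
      have h4 := (mem_filter.1 hb).2
      linarith
    have h1 : ∑ c ∈ C, #{s ∈ {s ∈ S | g s = a - b} | a - (s.1.1 - s.1.2) = c} ≤
        #{s ∈ S | g s = a - b} := by
      rw [sum_card_fiberwise_eq_card_filter]
      exact card_le_card (filter_subset _ _)
    have h2 : ∀ c ∈ C, (κ / 16 * #A) ^ 2 ≤
        (#{s ∈ {s ∈ S | g s = a - b} | a - (s.1.1 - s.1.2) = c} : ℝ) := by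
      intro c hc
      obtain ⟨-, hc1, hc2⟩ := mem_filter.1 hc
      have hsub : {p ∈ A ×ˢ A | p.1 - p.2 = a - c} ×ˢ {p ∈ A ×ˢ A | p.1 - p.2 = b - c} ⊆
          {s ∈ {s ∈ S | g s = a - b} | a - (s.1.1 - s.1.2) = c} := by
        rintro ⟨p, q⟩ hpq
        simp only [hS, hg, mem_product, mem_filter] at hpq ⊢
        obtain ⟨⟨h1, h2⟩, h3, h4⟩ := hpq
        refine ⟨⟨⟨h1, h3⟩, ?_⟩, ?_⟩
        · rw [h2, h4]; abel
        · rw [h2]; abel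
      have h3 := card_le_card hsub
      rw [card_product] at h3
      have h4 : (diffRep A (a - c) : ℝ) * diffRep A (b - c) ≤
        (#{s ∈ {s ∈ S | g s = a - b} | a - (s.1.1 - s.1.2) = c} : ℝ) := by exact_mod_cast h3
      refine le_trans ?_ h4
      rw [sq]
      exact mul_le_mul (not_le.1 hc1).le (not_le.1 hc2).le (by positivity) (by positivity)
    calc _ ≤ (#C : ℝ) * (κ / 16 * #A) ^ 2 := by gcongr
      _ = ∑ c ∈ C, (κ / 16 * (#A : ℝ)) ^ 2 := by rw [sum_const, nsmul_eq_mul]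
      _ ≤ ∑ c ∈ C, (#{s ∈ {s ∈ S | g s = a - b} | a - (s.1.1 - s.1.2) = c} : ℝ) :=
          sum_le_sum h2
      _ ≤ _ := by exact_mod_cast h1
  have htot : (#(A' - A') : ℝ) * ((#X : ℝ) / 2 * (κ / 16 * #A) ^ 2) ≤ (#A : ℝ) ^ 4 := by
    calc _ = ∑ d ∈ A' - A', ((#X : ℝ) / 2 * (κ / 16 * #A) ^ 2) := by
          rw [sum_const, nsmul_eq_mul]
      _ ≤ ∑ d ∈ A' - A', (#{s ∈ S | g s = d} : ℝ) := sum_le_sum hrep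
      _ = (#{s ∈ S | g s ∈ A' - A'} : ℝ) := by
          rw [← sum_card_fiberwise_eq_card_filter, Nat.cast_sum]
      _ ≤ (#S : ℝ) := by exact_mod_cast card_le_card (filter_subset _ _)
      _ = (#A : ℝ) ^ 4 := by rw [hS, card_product, card_product]; push_cast; ring
  have hD : (#(A' - A') : ℝ) * (κ ^ 3 / 1024) ≤ #A := by
    have h1 : (#(A' - A') : ℝ) * (κ ^ 3 / 1024 * (#A : ℝ) ^ 3) ≤ (#A : ℝ) ^ 4 := by
      refine le_trans (mul_le_mul_of_nonneg_left ?_ (Nat.cast_nonneg _)) htot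
      calc κ ^ 3 / 1024 * (#A : ℝ) ^ 3 = (κ / 2 * #A) / 2 * (κ / 16 * #A) ^ 2 := by ring
        _ ≤ _ := by gcongr
    have h2 : (#(A' - A') : ℝ) * (κ ^ 3 / 1024) * (#A : ℝ) ^ 3 ≤ #A * (#A : ℝ) ^ 3 := by
      linarith
    exact le_of_mul_le_mul_right h2 (by positivity)
  rw [div_mul_eq_mul_div, le_div_iff₀ (by positivity)]
  have h3 : (#(A' - A') : ℝ) * (κ ^ 3 / 1024) * (κ / 4) ≤ #A * (κ / 4) := by gcongr
  linarith

end AdditiveCombinatorics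

/-! ### Freiman's theorem over `𝔽₅` and affine structure of graphs. -/

section Freiman

open Finset
open scoped Pointwise

instance fact_prime_five : Fact (Nat.Prime 5) := ⟨by norm_num⟩

theorem card_span_finset_le {G : Type*} [AddCommGroup G] [Module (ZMod 5) G] [Finite G]
    (F : Finset G) : Nat.card (Submodule.span (ZMod 5) (F : Set G)) ≤ 5 ^ #F := by
  classical
  have := Fintype.ofFinite (Submodule.span (ZMod 5) (F : Set G))
  rw [Nat.card_eq_fintype_card, Module.card_eq_pow_finrank (K := ZMod 5), ZMod.card]
  exact Nat.pow_le_pow_right (by norm_num) (finrank_span_finset_le_card F)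

/-- Freiman's theorem in vector spaces over `𝔽₅`. -/
theorem exists_submodule_of_card_sub_le {G : Type*} [AddCommGroup G] [DecidableEq G]
    [Module (ZMod 5) G] [Finite G] {A : Finset G} (hA : A.Nonempty) {K : ℕ}
    (hK : #(A - A) ≤ K * #A) :
    ∃ U : Submodule (ZMod 5) G, (∀ a ∈ A, ∀ b ∈ A, a - b ∈ U) ∧
      Nat.card U ≤ 5 ^ K ^ 5 * K * #A := by
  classical
  have hset : (A - A) + (A - A) + A = 3 • A - 2 • A := by
    simp only [sub_eq_add_neg, succ_nsmul, zero_nsmul, neg_add, zero_add]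
    generalize -A = B
    abel
  have h1 : (#((A - A) + (A - A) + A) : ℝ) ≤ (K : ℝ) ^ 5 * #A := by
    rw [hset]
    have hpr := pluennecke_ruzsa_inequality_nsmul_sub_nsmul_sub hA A 3 2
    have : (#(A - A) : ℚ≥0) / #A ≤ K := by
      rw [div_le_iff₀ (by exact_mod_cast hA.card_pos)]
      exact_mod_cast hK
    have h5 : (#(3 • A - 2 • A) : ℚ≥0) ≤ (K : ℚ≥0) ^ 5 * #A := hpr.trans (by gcongr)
    exact_mod_cast h5
  -- Covering gives `(A - A) + (A - A) ⊆ F + (A - A)`, so `S + (A - A)`, with `S` the span of `F`,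
  -- is closed under addition. Scalars of `𝔽₅` are repeated additions, so this set contains the span
  -- of `A - A`.
  obtain ⟨F, hF, hFK, hcov⟩ := ruzsa_covering_add hA h1
  have hFK' : #F ≤ K ^ 5 := by exact_mod_cast hFK
  set S := Submodule.span (ZMod 5) (F : Set G) with hS
  have hclosed : ∀ u ∈ Submodule.span (ZMod 5) ((A - A : Finset G) : Set G),
      ∃ s ∈ S, ∃ d ∈ A - A, u = s + d := by
    obtain ⟨a₀, ha₀⟩ := hA
    have h0 : (0 : G) ∈ A - A := by
      rw [← sub_self a₀]; exact sub_mem_sub ha₀ ha₀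
    have hadd : ∀ x y : G, (∃ s ∈ S, ∃ d ∈ A - A, x = s + d) →
        (∃ s ∈ S, ∃ d ∈ A - A, y = s + d) → ∃ s ∈ S, ∃ d ∈ A - A, x + y = s + d := by
      rintro _ _ ⟨s, hs, d, hd, rfl⟩ ⟨s', hs', d', hd', rfl⟩
      obtain ⟨f, hf, e, he, hfe⟩ := mem_add.1 (hcov (add_mem_add hd hd'))
      refine ⟨s + s' + f, S.add_mem (S.add_mem hs hs') (Submodule.subset_span hf), e, he, ?_⟩
      rw [add_assoc (s + s'), hfe]; abel
    intro u hu
    induction hu using Submodule.span_induction with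
    | mem x hx => exact ⟨0, S.zero_mem, x, hx, by simp⟩
    | zero => exact ⟨0, S.zero_mem, 0, h0, by simp⟩
    | add x y _ _ hx hy => exact hadd x y hx hy
    | smul c x _ hx =>
      have hn : ∀ k : ℕ, ∃ s ∈ S, ∃ d ∈ A - A, k • x = s + d := by
        intro k
        induction k with
        | zero => exact ⟨0, S.zero_mem, 0, h0, by simp⟩
        | succ k ih => rw [succ_nsmul]; exact hadd _ _ ih hx
      have : c • x = (ZMod.val c) • x := by
        rw [← Nat.cast_smul_eq_nsmul (ZMod 5), ZMod.natCast_zmod_val]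
      rw [this]
      exact hn _
  refine ⟨Submodule.span (ZMod 5) ((A - A : Finset G) : Set G),
    fun a ha b hb => Submodule.subset_span (by exact_mod_cast sub_mem_sub ha hb), ?_⟩
  have hsub : ((Submodule.span (ZMod 5) ((A - A : Finset G) : Set G) : Set G)) ⊆
      (fun p : G × G => p.1 + p.2) '' ((S : Set G) ×ˢ ((A - A : Finset G) : Set G)) := by
    intro u hu
    obtain ⟨s, hs, d, hd, rfl⟩ := hclosed u hu
    exact ⟨(s, d), ⟨hs, hd⟩, rfl⟩
  calc Nat.card (Submodule.span (ZMod 5) ((A - A : Finset G) : Set G))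
      = Set.ncard (Submodule.span (ZMod 5) ((A - A : Finset G) : Set G) : Set G) := rfl
    _ ≤ _ := Set.ncard_le_ncard hsub (Set.toFinite _)
    _ ≤ Set.ncard ((S : Set G) ×ˢ ((A - A : Finset G) : Set G)) :=
        Set.ncard_image_le (Set.toFinite _)
    _ = Nat.card S * #(A - A) := by
        rw [Set.ncard_prod, Set.ncard_coe_finset]; rfl
    _ ≤ 5 ^ K ^ 5 * (K * #A) := by
        refine Nat.mul_le_mul ?_ hK
        exact (card_span_finset_le F).trans (Nat.pow_le_pow_right (by norm_num) hFK')
    _ = _ := by ring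

/-- A function whose graph has small doubling agrees with an affine map on a large set. -/
theorem exists_affine_of_small_doubling {n : ℕ} {H : Finset (F5Vec n)} (hH : H.Nonempty)
    (ξ : F5Vec n → F5Vec n) {K : ℕ}
    (hK : #(H.image (fun h => (h, ξ h)) - H.image (fun h => (h, ξ h))) ≤ K * #H) :
    ∃ (M : Matrix (Fin n) (Fin n) (ZMod 5)) (b : F5Vec n),
      #H ≤ 5 ^ K ^ 5 * K * #{h ∈ H | ξ h = M *ᵥ h + b} := by
  classical
  set Γ := H.image (fun h => (h, ξ h)) with hΓ
  have hinj : Function.Injective (fun h => (h, ξ h)) := fun a b h => (Prod.ext_iff.1 h).1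
  have hcardΓ : #Γ = #H := card_image_of_injective _ hinj
  obtain ⟨U, hU, hUcard⟩ := exists_submodule_of_card_sub_le (hH.image _) (by rw [hcardΓ]; exact hK)
  obtain ⟨h₀, hh₀⟩ := hH
  have hUH : ∀ h ∈ H, ((h, ξ h) - (h₀, ξ h₀) : F5Vec n × F5Vec n) ∈ U := fun h hh =>
    hU _ (mem_image_of_mem _ hh) _ (mem_image_of_mem _ hh₀)
  set p : U →ₗ[ZMod 5] F5Vec n := (LinearMap.fst (ZMod 5) (F5Vec n) (F5Vec n)) ∘ₗ U.subtype with hp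
  -- A linear section of the first projection of `U`; its second coordinate, extended to the whole
  -- space, is the linear part `L`. Over `H`, `ξ` differs from an affine map with linear part `L`
  -- only by elements of the vertical fibre `W`.
  obtain ⟨s, hs⟩ := LinearMap.exists_rightInverse_of_surjective p.rangeRestrict
    (LinearMap.range_rangeRestrict p)
  obtain ⟨L, hL⟩ := LinearMap.exists_extend
    ((LinearMap.snd (ZMod 5) (F5Vec n) (F5Vec n)) ∘ₗ U.subtype ∘ₗ s)
  have hLU : ∀ x ∈ LinearMap.range p, ((x, L x) : F5Vec n × F5Vec n) ∈ U := by
    intro x hx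
    have h1 : p (s ⟨x, hx⟩) = x := by
      have := LinearMap.congr_fun hs ⟨x, hx⟩
      exact congrArg Subtype.val this
    have h2 : L x = (s ⟨x, hx⟩ : F5Vec n × F5Vec n).2 := LinearMap.congr_fun hL ⟨x, hx⟩
    have : ((x, L x) : F5Vec n × F5Vec n) = s ⟨x, hx⟩ := Prod.ext h1.symm h2
    rw [this]
    exact (s ⟨x, hx⟩).2
  have hker : ∀ h ∈ H, ((0, ξ h - ξ h₀ - L (h - h₀)) : F5Vec n × F5Vec n) ∈ U := by
    intro h hh
    have h1 := hUH h hh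
    have h2 := hLU (h - h₀) ⟨⟨_, h1⟩, rfl⟩
    have h3 := U.sub_mem h1 h2
    simpa using h3
  set W : Finset (F5Vec n) := {v | ((0, v) : F5Vec n × F5Vec n) ∈ U} with hW
  -- Vertical translates of the shifted graph by elements of `W` are disjoint inside `U`. Hence `W`
  -- is bounded, and one `v ∈ W` serves a proportion `1 / C` of `H`.
  have hWcard : #W * #H ≤ Nat.card U := by
    have hm : Set.MapsTo (fun q : F5Vec n × F5Vec n => ((0, q.1) : F5Vec n × F5Vec n) +
        ((q.2, ξ q.2) - (h₀, ξ h₀))) (W ×ˢ H : Finset _) (U : Set (F5Vec n × F5Vec n)) := by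
      rintro ⟨v, h⟩ hvh
      rw [coe_product, Set.mem_prod] at hvh
      exact U.add_mem (mem_filter.1 hvh.1).2 (hUH h hvh.2)
    have hi : Set.InjOn (fun q : F5Vec n × F5Vec n => ((0, q.1) : F5Vec n × F5Vec n) +
        ((q.2, ξ q.2) - (h₀, ξ h₀))) (W ×ˢ H : Finset _) := by
      rintro ⟨v, h⟩ - ⟨v', h'⟩ - heq
      simp only [Prod.mk_sub_mk, Prod.mk_add_mk, Prod.mk.injEq] at heq
      obtain ⟨e1, e2⟩ := heq
      have : h = h' := by simpa using e1
      subst this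
      have : v = v' := by simpa using e2
      rw [this]
    have := Set.ncard_le_ncard_of_injOn _ hm hi (Set.toFinite _)
    rwa [Set.ncard_coe_finset, card_product] at this
  set C := 5 ^ K ^ 5 * K with hC
  have hWC : #W ≤ C := by
    have hHpos : 0 < #H := card_pos.2 ⟨h₀, hh₀⟩
    rw [hcardΓ] at hUcard
    exact Nat.le_of_mul_le_mul_right (hWcard.trans hUcard) hHpos
  have hfib : ∑ v ∈ W, #{h ∈ H | ξ h - ξ h₀ - L (h - h₀) = v} = #H := by
    rw [sum_card_fiberwise_eq_card_filter]
    congr 1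
    exact filter_true_of_mem fun h hh => mem_filter.2 ⟨mem_univ _, hker h hh⟩
  obtain ⟨v, hv, hvmax⟩ := exists_max_image W (fun v => #{h ∈ H | ξ h - ξ h₀ - L (h - h₀) = v})
    ⟨0, mem_filter.2 ⟨mem_univ _, U.zero_mem⟩⟩
  refine ⟨LinearMap.toMatrix' L, ξ h₀ - L h₀ + v, ?_⟩
  have hset : {h ∈ H | ξ h = LinearMap.toMatrix' L *ᵥ h + (ξ h₀ - L h₀ + v)} =
      {h ∈ H | ξ h - ξ h₀ - L (h - h₀) = v} := by
    refine filter_congr fun h _ => ?_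
    rw [LinearMap.toMatrix'_mulVec, map_sub]
    constructor
    · intro e; rw [e]; abel
    · intro e; rw [← e]; abel
  rw [hset]
  calc #H = ∑ v ∈ W, #{h ∈ H | ξ h - ξ h₀ - L (h - h₀) = v} := hfib.symm
    _ ≤ #W * #{h ∈ H | ξ h - ξ h₀ - L (h - h₀) = v} := by
        rw [← smul_eq_mul]; exact sum_le_card_nsmul _ _ _ hvmax
    _ ≤ _ := Nat.mul_le_mul_right _ hWC

end Freiman

/-! ### From large `U³`-norm to affine frequencies of derivatives. -/

section Derivatives

open scoped Pointwise

variable {n : ℕ}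

/-- The multiplicative derivative `x ↦ f(x) f(x + h)`, as a complex function. -/
noncomputable def mulDeriv (f : F5Vec n → ℝ) (h x : F5Vec n) : ℂ := (f x : ℂ) * f (x + h)

theorem norm_mulDeriv_le {f : F5Vec n → ℝ} (hf : ∀ x, |f x| ≤ 1) (h x : F5Vec n) :
    ‖mulDeriv f h x‖ ≤ 1 := by
  rw [mulDeriv, norm_mul, Complex.norm_real, Complex.norm_real]
  exact mul_le_one₀ (hf _) (norm_nonneg _) (hf _)

theorem conj_mulDeriv (f : F5Vec n → ℝ) (h x : F5Vec n) :
    (starRingEnd ℂ) (mulDeriv f h x) = mulDeriv f h x := by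
  simp [mulDeriv]

theorem gowersU3Pow_eq_expect_mulDeriv (f : F5Vec n → ℝ) :
    (gowersU3Pow f : ℂ) = 𝔼 h, 𝔼 a, 𝔼 b, 𝔼 c,
      mulDeriv f h a * mulDeriv f h b * mulDeriv f h c * mulDeriv f h (b + c - a) := by
  unfold gowersU3Pow
  simp only [ofReal_expect', Complex.ofReal_mul]
  have h1 : ∀ g : F5Vec n → F5Vec n → F5Vec n → F5Vec n → ℂ,
      𝔼 x, 𝔼 h₁, 𝔼 h₂, 𝔼 h₃, g x h₁ h₂ h₃ = 𝔼 h₃, 𝔼 x, 𝔼 h₁, 𝔼 h₂, g x h₁ h₂ h₃ := by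
    intro g
    rw [Finset.expect_comm (M := ℂ) (f := fun h₃ x => 𝔼 h₁, 𝔼 h₂, g x h₁ h₂ h₃)]
    refine Finset.expect_congr rfl fun x _ => ?_
    rw [Finset.expect_comm (f := fun h₃ h₁ => 𝔼 h₂, g x h₁ h₂ h₃)]
    refine Finset.expect_congr rfl fun h₁ _ => ?_
    rw [Finset.expect_comm]
  rw [h1]
  refine Finset.expect_congr rfl fun h _ => Finset.expect_congr rfl fun a _ => ?_
  symm
  rw [expect_shift a]
  refine Finset.expect_congr rfl fun h₁ _ => ?_
  rw [expect_shift a]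
  refine Finset.expect_congr rfl fun h₂ _ => ?_
  have e : a + h₁ + (a + h₂) - a = a + h₁ + h₂ := by abel
  rw [e]
  simp only [mulDeriv]
  ring

theorem exists_large_mulDeriv_coeff {f : F5Vec n → ℝ} (hf : ∀ x, |f x| ≤ 1) :
    ∃ ξ : F5Vec n → F5Vec n, gowersU3Pow f ≤ 𝔼 h, ‖fourierCoeff5 (mulDeriv f h) (ξ h)‖ := by
  have h : ∀ h, ∃ ξ, ‖𝔼 a, 𝔼 b, 𝔼 c, mulDeriv f h a * mulDeriv f h b * mulDeriv f h c *
      mulDeriv f h (b + c - a)‖ ≤ ‖fourierCoeff5 (mulDeriv f h) ξ‖ := fun h =>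
    exists_le_norm_fourierCoeff5 (norm_mulDeriv_le hf h) (norm_mulDeriv_le hf h)
      (norm_mulDeriv_le hf h)
  choose ξ hξ using h
  refine ⟨ξ, ?_⟩
  calc gowersU3Pow f ≤ ‖(gowersU3Pow f : ℂ)‖ := by
        rw [Complex.norm_real]; exact le_abs_self _
    _ ≤ _ := by
        rw [gowersU3Pow_eq_expect_mulDeriv]
        exact (RCLike.norm_expect_le (K := ℂ)).trans
          (Finset.expect_le_expect fun h _ => hξ h)

theorem norm_fourierCoeff5_le_one {u : F5Vec n → ℂ} (hu : ∀ x, ‖u x‖ ≤ 1) (ξ : F5Vec n) :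
    ‖fourierCoeff5 u ξ‖ ≤ 1 :=
  norm_expect_le_one fun x => by rw [norm_mul, norm_e5, mul_one]; exact hu x

/-- If the average of a `[0, 1]`-valued function is at least `2c`, it is at least `c` on a set of
density at least `c`. -/
theorem exists_finset_of_le_expect {g : F5Vec n → ℝ} (hg : ∀ x, g x ≤ 1) {c : ℝ}
    (hc : 2 * c ≤ 𝔼 x, g x) (hc0 : 0 ≤ c) :
    ∃ H : Finset (F5Vec n), (∀ h ∈ H, c ≤ g h) ∧ c * Fintype.card (F5Vec n) ≤ H.card := by
  classical
  refine ⟨Finset.univ.filter fun h => c ≤ g h, fun h hh => (Finset.mem_filter.1 hh).2, ?_⟩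
  have hN : (0 : ℝ) < Fintype.card (F5Vec n) := by exact_mod_cast Fintype.card_pos
  rw [Fintype.expect_eq_sum_div_card, le_div_iff₀ hN] at hc
  have : ∑ x, g x ≤ ∑ x, ((if c ≤ g x then (1 : ℝ) else 0) + c) := by
    refine Finset.sum_le_sum fun x _ => ?_
    split_ifs with h
    · linarith [hg x]
    · linarith
  rw [Finset.sum_add_distrib, Finset.sum_boole, Finset.sum_const, nsmul_eq_mul,
    Finset.card_univ] at this
  linarith

/-- The form of Cauchy–Schwarz used throughout to discard a bounded factor. -/
theorem expect_norm_sq_of_bounded_le {ι κ : Type*} [Fintype ι] [Nonempty ι] [Fintype κ]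
    [Nonempty κ] {a b : ι → κ → ℂ} (ha : ∀ i j, ‖a i j‖ ≤ 1) :
    ‖𝔼 i, 𝔼 j, a i j * b i j‖ ^ 2 ≤ 𝔼 i, 𝔼 j, ‖b i j‖ ^ 2 := by
  have h1 : ‖𝔼 i, 𝔼 j, a i j * b i j‖ ≤ 𝔼 i, 𝔼 j, ‖b i j‖ := by
    refine (RCLike.norm_expect_le (K := ℂ)).trans (Finset.expect_le_expect fun i _ => ?_)
    refine (RCLike.norm_expect_le (K := ℂ)).trans (Finset.expect_le_expect fun j _ => ?_)
    rw [norm_mul]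
    exact mul_le_of_le_one_left (norm_nonneg _) (ha i j)
  calc _ ≤ (𝔼 i, 𝔼 j, ‖b i j‖) ^ 2 := by gcongr
    _ ≤ 𝔼 i, (𝔼 j, ‖b i j‖) ^ 2 := expect_sq_le _
    _ ≤ _ := Finset.expect_le_expect fun i _ => expect_sq_le _

/-- Parseval for the push-forward of the weight `a` under `v`. -/
theorem expect_norm_sq_expect_e5 (a : F5Vec n → ℝ) (v : F5Vec n → F5Vec n) :
    𝔼 k, ‖𝔼 h, (a h : ℂ) * e5 (v h ⬝ᵥ k)‖ ^ 2 =
      (∑ e, (∑ h, if v h = e then a h else 0) ^ 2) / (Fintype.card (F5Vec n) : ℝ) ^ 2 := by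
  set u : F5Vec n → ℂ := fun e => ((∑ h, if v h = e then a h else 0 : ℝ) : ℂ) with hu
  have h1 : ∀ k, 𝔼 h, (a h : ℂ) * e5 (v h ⬝ᵥ k) = fourierCoeff5 u k := by
    intro k
    simp only [fourierCoeff5, hu, Fintype.expect_eq_sum_div_card]
    congr 1
    simp only [Complex.ofReal_sum, Finset.sum_mul]
    rw [Finset.sum_comm]
    refine Finset.sum_congr rfl fun h _ => ?_
    rw [Finset.sum_eq_single (v h)]
    · simp [dotProduct_comm]
    · intro e _ he
      simp [he.symm]
    · simp
  simp only [h1]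
  rw [Fintype.expect_eq_sum_div_card, sum_norm_fourierCoeff5_sq, Fintype.expect_eq_sum_div_card,
    div_div, ← sq]
  congr 1
  refine Finset.sum_congr rfl fun e _ => ?_
  rw [hu, Complex.norm_real, Real.norm_eq_abs, sq_abs]

theorem diffRep_graph (H : Finset (F5Vec n)) (ξ : F5Vec n → F5Vec n) (d e : F5Vec n) :
    (diffRep (H.image fun h => (h, ξ h)) (d, e) : ℝ) =
      ∑ h, if ξ (h + d) - ξ h = e then
        ((if h ∈ H then (1 : ℝ) else 0) * if h + d ∈ H then 1 else 0) else 0 := by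
  classical
  have : ∀ h, (if ξ (h + d) - ξ h = e then
        ((if h ∈ H then (1 : ℝ) else 0) * if h + d ∈ H then 1 else 0) else 0) =
      if ξ (h + d) - ξ h = e ∧ h ∈ H ∧ h + d ∈ H then 1 else 0 := by
    intro h
    split_ifs <;> simp_all
  simp only [this]
  rw [Finset.sum_boole, diffRep]
  congr 1
  refine Finset.card_nbij' (fun p => p.2.1) (fun h => ((h + d, ξ (h + d)), (h, ξ h))) ?_ ?_ ?_ ?_
  · rintro ⟨p, q⟩ hpq
    simp only [Finset.coe_filter, Finset.mem_product, Set.mem_ofPred_eq, Finset.mem_image,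
      Finset.mem_univ, true_and] at hpq ⊢
    obtain ⟨⟨⟨a, ha, rfl⟩, b, hb, rfl⟩, h⟩ := hpq
    simp only [Prod.mk_sub_mk, Prod.mk.injEq] at h
    obtain ⟨rfl, rfl⟩ := h
    simp [ha, hb]
  · intro h hh
    simp only [Finset.coe_filter, Finset.mem_product, Set.mem_ofPred_eq, Finset.mem_image,
      Finset.mem_univ, true_and] at hh ⊢
    refine ⟨⟨⟨_, hh.2.2, rfl⟩, _, hh.2.1, rfl⟩, ?_⟩
    simp [hh.1]
  · rintro ⟨p, q⟩ hpq
    simp only [Finset.coe_filter, Finset.mem_product, Set.mem_ofPred_eq, Finset.mem_image] at hpq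
    obtain ⟨⟨⟨a, ha, rfl⟩, b, hb, rfl⟩, h⟩ := hpq
    simp only [Prod.mk_sub_mk, Prod.mk.injEq] at h
    obtain ⟨rfl, rfl⟩ := h
    simp
  · intro h _
    rfl

/-- Two Cauchy–Schwarz steps eliminate `f`, leaving only the frequencies. Both rest on the symmetry
between `h` and `k` in `f(x) f(x+h) f(x+k) f(x+h+k)`: after the square is expanded, it is a product
of derivatives in direction `k`. -/
theorem expect_weighted_coeff_pow_four_le {f : F5Vec n → ℝ} (hf : ∀ x, |f x| ≤ 1)
    (w : F5Vec n → ℝ) (ξ : F5Vec n → F5Vec n) :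
    (𝔼 h, w h * ‖fourierCoeff5 (mulDeriv f h) (ξ h)‖ ^ 2) ^ 4 ≤
      𝔼 d, 𝔼 k, ‖𝔼 h, ((w h * w (h + d) : ℝ) : ℂ) * e5 ((ξ (h + d) - ξ h) ⬝ᵥ k)‖ ^ 2 := by
  set S₁ := 𝔼 h, w h * ‖fourierCoeff5 (mulDeriv f h) (ξ h)‖ ^ 2 with hS₁
  set b : F5Vec n → F5Vec n → ℂ := fun k x =>
    𝔼 h, (w h : ℂ) * mulDeriv f k (x + h) * e5 (-(ξ h ⬝ᵥ k)) with hb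
  set S₂ := 𝔼 k, 𝔼 x, ‖b k x‖ ^ 2 with hS₂
  have h1 : (S₁ : ℂ) = 𝔼 k, 𝔼 x, mulDeriv f k x * b k x := by
    rw [hS₁, ofReal_expect']
    simp only [Complex.ofReal_mul, fourierCoeff5, normSq_expect_shift]
    simp only [hb, Finset.mul_expect]
    have hcomm : ∀ g : F5Vec n → F5Vec n → F5Vec n → ℂ,
        𝔼 h, 𝔼 x, 𝔼 k, g h x k = 𝔼 k, 𝔼 x, 𝔼 h, g h x k := by
      intro g
      simp_rw [fun h => Finset.expect_comm Finset.univ Finset.univ (g h)]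
      rw [Finset.expect_comm]
      exact Finset.expect_congr rfl fun k _ => Finset.expect_comm _ _ _
    rw [hcomm]
    refine Finset.expect_congr rfl fun k _ => Finset.expect_congr rfl fun x _ =>
      Finset.expect_congr rfl fun h _ => ?_
    have e : -(ξ h ⬝ᵥ k) = ξ h ⬝ᵥ x + -(ξ h ⬝ᵥ (x + k)) := by rw [dotProduct_add]; ring
    rw [map_mul, conj_mulDeriv, conj_e5, e, e5_add]
    simp only [mulDeriv]
    rw [add_right_comm x k h]
    ring
  have h2 : S₁ ^ 2 ≤ S₂ := by
    have := expect_norm_sq_of_bounded_le (a := mulDeriv f) (b := b) (norm_mulDeriv_le hf)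
    rwa [← h1, Complex.norm_real, Real.norm_eq_abs, sq_abs] at this
  set r : F5Vec n → F5Vec n → ℂ := fun d k => 𝔼 x, mulDeriv f k x * mulDeriv f k (x + d) with hr
  have h3 : (S₂ : ℂ) = 𝔼 d, 𝔼 k, r d k *
      𝔼 h, ((w h * w (h + d) : ℝ) : ℂ) * e5 ((ξ (h + d) - ξ h) ⬝ᵥ k) := by
    rw [hS₂, ofReal_expect']
    simp only [ofReal_expect', hb, normSq_expect_shift]
    have hcomm : ∀ g : F5Vec n → F5Vec n → F5Vec n → F5Vec n → ℂ,
        𝔼 k, 𝔼 x, 𝔼 h, 𝔼 d, g k x h d = 𝔼 d, 𝔼 k, 𝔼 h, 𝔼 x, g k x h d := by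
      intro g
      rw [Finset.expect_comm (f := fun d k => 𝔼 h, 𝔼 x, g k x h d)]
      refine Finset.expect_congr rfl fun k _ => ?_
      rw [Finset.expect_comm]
      rw [Finset.expect_comm (f := fun d h => 𝔼 x, g k x h d)]
      refine Finset.expect_congr rfl fun h _ => ?_
      rw [Finset.expect_comm]
    rw [hcomm]
    refine Finset.expect_congr rfl fun d _ => Finset.expect_congr rfl fun k _ => ?_
    rw [Finset.mul_expect]
    refine Finset.expect_congr rfl fun h _ => ?_
    symm
    rw [hr]
    simp only
    rw [expect_shift h, Finset.expect_mul]
    refine Finset.expect_congr rfl fun x _ => ?_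
    have e : (ξ (h + d) - ξ h) ⬝ᵥ k = -(ξ h ⬝ᵥ k) + ξ (h + d) ⬝ᵥ k := by
      rw [sub_dotProduct]; ring
    rw [map_mul, map_mul, conj_mulDeriv, conj_e5, neg_neg, e, e5_add, Complex.conj_ofReal,
      Complex.ofReal_mul, add_comm h x, add_assoc x h d]
    ring
  have h4 : S₂ ^ 2 ≤ 𝔼 d, 𝔼 k, ‖𝔼 h, ((w h * w (h + d) : ℝ) : ℂ) *
      e5 ((ξ (h + d) - ξ h) ⬝ᵥ k)‖ ^ 2 := by
    have := expect_norm_sq_of_bounded_le (a := r) (b := fun d k => 𝔼 h,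
      ((w h * w (h + d) : ℝ) : ℂ) * e5 ((ξ (h + d) - ξ h) ⬝ᵥ k)) (fun d k =>
        norm_expect_le_one fun x => by
          rw [norm_mul]
          exact mul_le_one₀ (norm_mulDeriv_le hf _ _) (norm_nonneg _) (norm_mulDeriv_le hf _ _))
    rwa [← h3, Complex.norm_real, Real.norm_eq_abs, sq_abs] at this
  calc S₁ ^ 4 = (S₁ ^ 2) ^ 2 := by ring
    _ ≤ S₂ ^ 2 := by gcongr
    _ ≤ _ := h4

/-- The graph of a function selecting large Fourier coefficients of derivatives has large
additive energy. -/
theorem energy_graph_ge {f : F5Vec n → ℝ} (hf : ∀ x, |f x| ≤ 1) {ξ : F5Vec n → F5Vec n}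
    {H : Finset (F5Vec n)} {c : ℝ} (hc : 0 ≤ c)
    (hH : ∀ h ∈ H, c ≤ ‖fourierCoeff5 (mulDeriv f h) (ξ h)‖)
    (hcard : c * Fintype.card (F5Vec n) ≤ H.card) :
    c ^ 12 * (Fintype.card (F5Vec n) : ℝ) ^ 3 ≤
      ∑ x, (diffRep (H.image fun h => (h, ξ h)) x : ℝ) ^ 2 := by
  have hN : (0 : ℝ) < Fintype.card (F5Vec n) := by exact_mod_cast Fintype.card_pos
  set w : F5Vec n → ℝ := fun h => if h ∈ H then 1 else 0 with hw
  have h1 : c ^ 3 ≤ 𝔼 h, w h * ‖fourierCoeff5 (mulDeriv f h) (ξ h)‖ ^ 2 := by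
    rw [Fintype.expect_eq_sum_div_card, le_div_iff₀ hN]
    calc c ^ 3 * Fintype.card (F5Vec n) = c * Fintype.card (F5Vec n) * c ^ 2 := by ring
      _ ≤ H.card * c ^ 2 := by gcongr
      _ = ∑ h ∈ H, c ^ 2 := by rw [Finset.sum_const, nsmul_eq_mul]
      _ ≤ ∑ h ∈ H, ‖fourierCoeff5 (mulDeriv f h) (ξ h)‖ ^ 2 :=
          Finset.sum_le_sum fun h hh => pow_le_pow_left₀ hc (hH h hh) 2
      _ = _ := by simp [hw, Finset.sum_ite_mem]
  have h2 := expect_weighted_coeff_pow_four_le hf w ξ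
  -- An opaque name, so that the rewriting of averages below affects only the right side of `h2`.
  obtain ⟨S, hS⟩ : ∃ S, S = 𝔼 h, w h * ‖fourierCoeff5 (mulDeriv f h) (ξ h)‖ ^ 2 := ⟨_, rfl⟩
  rw [← hS] at h1 h2
  simp only [expect_norm_sq_expect_e5] at h2
  rw [Fintype.expect_eq_sum_div_card, ← Finset.sum_div, div_div, ← pow_succ] at h2
  have h3 : c ^ 12 ≤ S ^ 4 := by
    calc c ^ 12 = (c ^ 3) ^ 4 := by ring
      _ ≤ _ := by gcongr
  rw [← le_div_iff₀ (by positivity)]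
  refine (h3.trans h2).trans_eq ?_
  congr 1
  rw [Fintype.sum_prod_type]
  refine Finset.sum_congr rfl fun d _ => Finset.sum_congr rfl fun e _ => ?_
  rw [diffRep_graph]

/-- The derivatives of a function with large `U³`-norm correlate with characters whose frequency
depends on the direction in an affine manner. -/
theorem exists_affine_mulDeriv_coeff {η : ℝ} (hη : 0 < η) :
    ∃ c : ℝ, 0 < c ∧ ∀ (n : ℕ) (f : F5Vec n → ℝ), (∀ x, |f x| ≤ 1) → η ≤ gowersU3Pow f →
      ∃ (M : Matrix (Fin n) (Fin n) (ZMod 5)) (b : F5Vec n),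
        c ≤ 𝔼 h, ‖fourierCoeff5 (mulDeriv f h) (M *ᵥ h + b)‖ ^ 2 := by
  classical
  set c := η / 2 with hc
  have hc0 : 0 < c := by positivity
  set κ := c ^ 12 with hκ
  set K := ⌈4096 / κ ^ 4⌉₊ with hK
  have hK0 : 0 < K := Nat.ceil_pos.2 (by positivity)
  set C : ℕ := 5 ^ K ^ 5 * K with hC
  have hC0 : (0 : ℝ) < C := by
    have : 0 < C := by positivity
    exact_mod_cast this
  -- The set `H` has density `c`, Balog–Szemerédi–Gowers keeps `κ / 4` of it, Freiman `1 / C` of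
  -- that, and each remaining `h` contributes at least `c ^ 2`.
  refine ⟨κ / 4 * c / C * c ^ 2, by positivity, fun n f hf hη => ?_⟩
  obtain ⟨ξ, hξ⟩ := exists_large_mulDeriv_coeff hf
  obtain ⟨H, hH, hHcard⟩ := exists_finset_of_le_expect (c := c)
    (fun h => norm_fourierCoeff5_le_one (norm_mulDeriv_le hf h) (ξ h)) (by linarith) hc0.le
  have hen := energy_graph_ge hf hc0.le hH hHcard
  have hN : (0 : ℝ) < Fintype.card (F5Vec n) := by exact_mod_cast Fintype.card_pos
  have hinj : Function.Injective (fun h => (h, ξ h)) := fun a b h => (Prod.ext_iff.1 h).1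
  have hΓ : (H.image fun h => (h, ξ h)).card = H.card := Finset.card_image_of_injective _ hinj
  have hH0 : (0 : ℝ) < H.card := lt_of_lt_of_le (by positivity) hHcard
  have hHne : H.Nonempty := Finset.card_pos.1 (by exact_mod_cast hH0)
  obtain ⟨A, hAΓ, hA0, hAcard, hAdoub⟩ := balog_szemeredi_gowers (κ := κ)
    (hHne.image fun h => (h, ξ h)) (by positivity) (by
      refine le_trans ?_ hen
      rw [hΓ]
      have : (H.card : ℝ) ≤ Fintype.card (F5Vec n) := by exact_mod_cast Finset.card_le_univ H
      gcongr)
  set H' := A.image Prod.fst with hH'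
  have hAH' : H'.image (fun h => (h, ξ h)) = A := by
    rw [hH', Finset.image_image]
    conv_rhs => rw [← Finset.image_id (s := A)]
    refine Finset.image_congr fun a ha => ?_
    obtain ⟨h, -, rfl⟩ := Finset.mem_image.1 (hAΓ ha)
    rfl
  have hH'card : H'.card = A.card := by
    rw [← hAH', Finset.card_image_of_injective _ hinj]
  have hH'H : H' ⊆ H := by
    intro h hh
    obtain ⟨a, ha, rfl⟩ := Finset.mem_image.1 hh
    obtain ⟨h', hh', rfl⟩ := Finset.mem_image.1 (hAΓ ha)
    exact hh'
  obtain ⟨M, b, hMb⟩ := exists_affine_of_small_doubling (hA0.image _) ξ (K := K) (by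
    change (H'.image (fun h => (h, ξ h)) - H'.image (fun h => (h, ξ h))).card ≤ K * H'.card
    rw [hAH', hH'card]
    have : ((A - A).card : ℝ) ≤ K * A.card := by
      refine hAdoub.trans ?_
      have := Nat.le_ceil (4096 / κ ^ 4)
      gcongr
    exact_mod_cast this)
  refine ⟨M, b, ?_⟩
  set H'' := {h ∈ H' | ξ h = M *ᵥ h + b} with hH''
  have h1 : (A.card : ℝ) ≤ C * H''.card := by
    rw [← hH'card]
    exact_mod_cast hMb
  rw [Fintype.expect_eq_sum_div_card, le_div_iff₀ hN]
  calc κ / 4 * c / C * c ^ 2 * Fintype.card (F5Vec n)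
      = κ / 4 * (c * Fintype.card (F5Vec n)) / C * c ^ 2 := by ring
    _ ≤ κ / 4 * H.card / C * c ^ 2 := by gcongr
    _ ≤ H''.card * c ^ 2 := by
        gcongr
        rw [div_le_iff₀ hC0]
        rw [hΓ] at hAcard
        linarith
    _ = ∑ h ∈ H'', c ^ 2 := by rw [Finset.sum_const, nsmul_eq_mul]
    _ ≤ ∑ h ∈ H'', ‖fourierCoeff5 (mulDeriv f h) (M *ᵥ h + b)‖ ^ 2 := by
        refine Finset.sum_le_sum fun h hh => ?_
        obtain ⟨h1, h2⟩ := Finset.mem_filter.1 hh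
        rw [← h2]
        exact pow_le_pow_left₀ hc0.le (hH h (hH'H h1)) 2
    _ ≤ _ := Finset.sum_le_sum_of_subset_of_nonneg (Finset.subset_univ _) fun _ _ _ => by positivity

end Derivatives

/-! ### Removing the antisymmetric part; the inverse theorem for `U³`. -/

section Symmetrization

variable {n : ℕ} {S A : Matrix (Fin n) (Fin n) (ZMod 5)}

theorem dotProduct_mulVec_eq_transpose (B : Matrix (Fin n) (Fin n) (ZMod 5)) (x y : F5Vec n) :
    x ⬝ᵥ (B *ᵥ y) = (Bᵀ *ᵥ x) ⬝ᵥ y := by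
  rw [Matrix.dotProduct_mulVec, Matrix.mulVec_transpose]

theorem dotProduct_mulVec_comm (hS : Sᵀ = S) (x y : F5Vec n) :
    x ⬝ᵥ (S *ᵥ y) = y ⬝ᵥ (S *ᵥ x) := by
  rw [dotProduct_mulVec_eq_transpose, hS, dotProduct_comm]

theorem dotProduct_mulVec_antisymm (hA : Aᵀ = -A) (x y : F5Vec n) :
    x ⬝ᵥ (A *ᵥ y) = -(y ⬝ᵥ (A *ᵥ x)) := by
  rw [dotProduct_mulVec_eq_transpose, hA, Matrix.neg_mulVec, neg_dotProduct, dotProduct_comm]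

theorem dotProduct_mulVec_self_eq_zero (hA : Aᵀ = -A) (x : F5Vec n) : x ⬝ᵥ (A *ᵥ x) = 0 := by
  have h := dotProduct_mulVec_antisymm hA x x
  generalize x ⬝ᵥ (A *ᵥ x) = t at h
  revert t
  decide

/-- The quadratic form `xᵀSx / 2`. -/
def halfForm (S : Matrix (Fin n) (Fin n) (ZMod 5)) (x : F5Vec n) : ZMod 5 := 3 * (x ⬝ᵥ (S *ᵥ x))

theorem halfForm_add (hS : Sᵀ = S) (x h : F5Vec n) :
    halfForm S (x + h) = halfForm S x + halfForm S h + x ⬝ᵥ (S *ᵥ h) := by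
  have h5 : (5 : ZMod 5) = 0 := rfl
  simp only [halfForm, Matrix.mulVec_add, dotProduct_add, add_dotProduct]
  rw [dotProduct_mulVec_comm hS h x]
  linear_combination (x ⬝ᵥ (S *ᵥ h)) * h5

/-- The `U²`-type average of `u` twisted by an alternating form. -/
noncomputable def twistedAverage (A : Matrix (Fin n) (Fin n) (ZMod 5)) (u : F5Vec n → ℂ) : ℂ :=
  𝔼 a, 𝔼 b, 𝔼 c, u a * (starRingEnd ℂ) (u b) * (starRingEnd ℂ) (u c) * u (b + c - a) *
    e5 ((b - a) ⬝ᵥ (A *ᵥ (c - a)))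

theorem expect_norm_sq_twisted (u : F5Vec n → ℂ) :
    ((𝔼 k, ‖𝔼 z, u z * (starRingEnd ℂ) (u (z + k)) * e5 (-(k ⬝ᵥ (A *ᵥ z)))‖ ^ 2 : ℝ) : ℂ) =
      twistedAverage A u := by
  rw [ofReal_expect', twistedAverage]
  simp only [normSq_expect_shift]
  rw [Finset.expect_comm]
  refine Finset.expect_congr rfl fun a _ => ?_
  symm
  rw [expect_shift a]
  refine Finset.expect_congr rfl fun k _ => ?_
  rw [expect_shift a]
  refine Finset.expect_congr rfl fun l _ => ?_
  have e1 : a + k + (a + l) - a = a + l + k := by abel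
  have e2 : (a + k - a) ⬝ᵥ (A *ᵥ (a + l - a)) =
      -(k ⬝ᵥ (A *ᵥ a)) + - -(k ⬝ᵥ (A *ᵥ (a + l))) := by
    rw [add_sub_cancel_left, add_sub_cancel_left, Matrix.mulVec_add, dotProduct_add]
    ring
  rw [e1, e2, e5_add, map_mul, map_mul, conj_e5, Complex.conj_conj]
  ring

/-- Since `y · Sh = q(y + h) - q(y) - q(h)` for `q = halfForm S`, the phase of `S` is absorbed into
`u` and `v`. The remaining phase of `A` splits between `x` and `x + h`, so the average is `𝔼 p F`,
and Cauchy–Schwarz drops the bounded `p`. -/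
theorem expect_coeff_sq_le_twistedAverage {f : F5Vec n → ℝ} (hf : ∀ x, |f x| ≤ 1)
    (hS : Sᵀ = S) (b : F5Vec n) :
    (𝔼 h, ‖fourierCoeff5 (mulDeriv f h) ((S + A) *ᵥ h + b)‖ ^ 2) ^ 2 ≤
      ‖twistedAverage A fun x => f x * e5 (halfForm S x)‖ := by
  set u : F5Vec n → ℂ := fun x => f x * e5 (halfForm S x) with hu
  set v : F5Vec n → ℂ := fun x => f x * e5 (b ⬝ᵥ x - halfForm S x) with hv
  have hv1 : ∀ x, ‖v x‖ ≤ 1 := fun x => by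
    rw [hv, norm_mul, norm_e5, mul_one, Complex.norm_real]; exact hf x
  set p : F5Vec n → ℂ := fun k => 𝔼 x, v x * (starRingEnd ℂ) (v (x + k)) * e5 (k ⬝ᵥ (A *ᵥ x))
    with hp
  set F : F5Vec n → ℂ := fun k => 𝔼 z, u z * (starRingEnd ℂ) (u (z + k)) *
    e5 (-(k ⬝ᵥ (A *ᵥ z))) with hF
  have hp1 : ∀ k, ‖p k‖ ≤ 1 := fun k => norm_expect_le_one fun x => by
    rw [norm_mul, norm_mul, norm_e5, mul_one, RCLike.norm_conj]
    exact mul_le_one₀ (hv1 _) (norm_nonneg _) (hv1 _)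
  have h1 : ((𝔼 h, ‖fourierCoeff5 (mulDeriv f h) ((S + A) *ᵥ h + b)‖ ^ 2 : ℝ) : ℂ) =
      𝔼 k, p k * F k := by
    rw [ofReal_expect']
    simp only [fourierCoeff5, normSq_expect_shift]
    have hcomm : ∀ g : F5Vec n → F5Vec n → F5Vec n → ℂ,
        𝔼 h, 𝔼 x, 𝔼 k, g h x k = 𝔼 k, 𝔼 x, 𝔼 h, g h x k := by
      intro g
      simp_rw [fun h => Finset.expect_comm Finset.univ Finset.univ (g h)]
      rw [Finset.expect_comm]
      exact Finset.expect_congr rfl fun k _ => Finset.expect_comm _ _ _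
    rw [hcomm]
    refine Finset.expect_congr rfl fun k _ => ?_
    rw [hp, hF]
    simp only
    rw [Finset.expect_mul]
    refine Finset.expect_congr rfl fun x _ => ?_
    symm
    rw [expect_shift x, Finset.mul_expect]
    refine Finset.expect_congr rfl fun h _ => ?_
    have hphase : ∀ y, ((S + A) *ᵥ h + b) ⬝ᵥ y =
        (b ⬝ᵥ y - halfForm S y) + (halfForm S (y + h) + (y ⬝ᵥ (A *ᵥ h) - halfForm S h)) := by
      intro y
      rw [halfForm_add hS, dotProduct_comm, Matrix.add_mulVec, dotProduct_add, dotProduct_add,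
        dotProduct_comm y b]
      ring
    have hx : mulDeriv f h x * e5 (((S + A) *ᵥ h + b) ⬝ᵥ x) =
        v x * u (x + h) * e5 (x ⬝ᵥ (A *ᵥ h) - halfForm S h) := by
      rw [hphase, e5_add, e5_add, hu, hv, mulDeriv]; ring
    have hxk : mulDeriv f h (x + k) * e5 (((S + A) *ᵥ h + b) ⬝ᵥ (x + k)) =
        v (x + k) * u (x + h + k) * e5 ((x + k) ⬝ᵥ (A *ᵥ h) - halfForm S h) := by
      rw [hphase, e5_add, e5_add, hu, hv, mulDeriv, add_right_comm x k h]; ring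
    have hph : (k ⬝ᵥ (A *ᵥ x)) + -(k ⬝ᵥ (A *ᵥ (x + h))) =
        (x ⬝ᵥ (A *ᵥ h) - halfForm S h) + -((x + k) ⬝ᵥ (A *ᵥ h) - halfForm S h) := by
      rw [Matrix.mulVec_add, dotProduct_add, add_dotProduct]; ring
    have hph' := congrArg e5 hph
    rw [e5_add, e5_add] at hph'
    rw [hx, hxk, map_mul (starRingEnd ℂ) (v (x + k) * u (x + h + k)),
      map_mul (starRingEnd ℂ) (v (x + k)), conj_e5]
    linear_combination v x * (starRingEnd ℂ) (v (x + k)) * u (x + h) *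
      (starRingEnd ℂ) (u (x + h + k)) * hph'
  have h2 := expect_norm_sq_of_bounded_le (a := fun k (_ : Unit) => p k) (b := fun k _ => F k)
    (fun k _ => hp1 k)
  simp only [Fintype.expect_const] at h2
  rw [← h1, Complex.norm_real, Real.norm_eq_abs, sq_abs] at h2
  refine h2.trans ?_
  rw [← expect_norm_sq_twisted, Complex.norm_real]
  exact le_abs_self _

/-- On expanding the square, the average over `a` kills every shift `k` outside the kernel of `A`.
-/
theorem expect_norm_sq_bilinear_le (hA : Aᵀ = -A) {β : F5Vec n → ℂ} (hβ : ∀ x, ‖β x‖ ≤ 1) :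
    𝔼 a, ‖𝔼 b, β b * e5 (-2 * (b ⬝ᵥ (A *ᵥ a)))‖ ^ 2 ≤
      𝔼 k, if A *ᵥ k = 0 then (1 : ℝ) else 0 := by
  have h1 : ((𝔼 a, ‖𝔼 b, β b * e5 (-2 * (b ⬝ᵥ (A *ᵥ a)))‖ ^ 2 : ℝ) : ℂ) =
      𝔼 b, 𝔼 k, β b * (starRingEnd ℂ) (β (b + k)) * if A *ᵥ k = 0 then 1 else 0 := by
    rw [ofReal_expect']
    simp only [normSq_expect_shift]
    rw [Finset.expect_comm]
    refine Finset.expect_congr rfl fun b _ => ?_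
    rw [Finset.expect_comm]
    refine Finset.expect_congr rfl fun k _ => ?_
    have h2 : ((-2 : ZMod 5) • (A *ᵥ k)) = 0 ↔ A *ᵥ k = 0 := by
      rw [smul_eq_zero]
      exact or_iff_right (by decide)
    have h3 := expect_e5_dot ((-2 : ZMod 5) • (A *ᵥ k))
    rw [if_congr h2 rfl rfl] at h3
    rw [← h3, Finset.mul_expect]
    refine Finset.expect_congr rfl fun a _ => ?_
    have e : ((-2 : ZMod 5) • (A *ᵥ k)) ⬝ᵥ a =
        -2 * (b ⬝ᵥ (A *ᵥ a)) + -(-2 * ((b + k) ⬝ᵥ (A *ᵥ a))) := by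
      rw [smul_dotProduct, add_dotProduct, dotProduct_mulVec_antisymm hA k a, dotProduct_comm,
        smul_eq_mul]
      ring
    rw [e, e5_add, map_mul (starRingEnd ℂ), conj_e5]
    ring
  calc _ ≤ ‖((𝔼 a, ‖𝔼 b, β b * e5 (-2 * (b ⬝ᵥ (A *ᵥ a)))‖ ^ 2 : ℝ) : ℂ)‖ := by
        rw [Complex.norm_real]; exact le_abs_self _
    _ ≤ 𝔼 b : F5Vec n, 𝔼 k, if A *ᵥ k = 0 then (1 : ℝ) else 0 := by
        rw [h1]
        refine (RCLike.norm_expect_le (K := ℂ)).trans (Finset.expect_le_expect fun b _ => ?_)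
        refine (RCLike.norm_expect_le (K := ℂ)).trans (Finset.expect_le_expect fun k _ => ?_)
        rw [norm_mul, norm_mul, RCLike.norm_conj]
        have := mul_le_one₀ (hβ b) (norm_nonneg _) (hβ (b + k))
        split_ifs
        · simpa using this
        · simp
    _ = _ := Fintype.expect_const _

/-- For fixed `s = b + c` the phase is a function of `a`, plus one of `b`, plus the bilinear term
`-2 bᵀAa`, to which the preceding bound applies. -/
theorem norm_twistedAverage_sq_le (hA : Aᵀ = -A) {u : F5Vec n → ℂ} (hu : ∀ x, ‖u x‖ ≤ 1) :
    ‖twistedAverage A u‖ ^ 2 ≤ 𝔼 k, if A *ᵥ k = 0 then (1 : ℝ) else 0 := by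
  set β : F5Vec n → F5Vec n → ℂ := fun s b => (starRingEnd ℂ) (u b) * (starRingEnd ℂ) (u (s - b)) *
    e5 (b ⬝ᵥ (A *ᵥ s)) with hβ
  have h1 : twistedAverage A u = 𝔼 s, 𝔼 a, (u a * u (s - a) * e5 (-(a ⬝ᵥ (A *ᵥ s)))) *
      𝔼 b, β s b * e5 (-2 * (b ⬝ᵥ (A *ᵥ a))) := by
    symm
    rw [twistedAverage, Finset.expect_comm]
    refine Finset.expect_congr rfl fun a _ => ?_
    simp only [Finset.mul_expect]
    rw [Finset.expect_comm]
    refine Finset.expect_congr rfl fun b _ => ?_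
    rw [expect_shift b]
    refine Finset.expect_congr rfl fun c _ => ?_
    have hph : (b - a) ⬝ᵥ (A *ᵥ (c - a)) = -(a ⬝ᵥ (A *ᵥ (b + c))) + (b ⬝ᵥ (A *ᵥ (b + c)) +
        -2 * (b ⬝ᵥ (A *ᵥ a))) := by
      simp only [Matrix.mulVec_add, Matrix.mulVec_sub, dotProduct_add, dotProduct_sub,
        sub_dotProduct, dotProduct_mulVec_self_eq_zero hA]
      rw [dotProduct_mulVec_antisymm hA a b]
      ring
    simp only [hβ]
    rw [hph, e5_add, e5_add, add_sub_cancel_left]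
    ring
  rw [h1]
  refine (expect_norm_sq_of_bounded_le fun s a => ?_).trans ?_
  · rw [norm_mul, norm_mul, norm_e5, mul_one]
    exact mul_le_one₀ (hu _) (norm_nonneg _) (hu _)
  · refine Finset.expect_le Finset.univ_nonempty fun s _ => expect_norm_sq_bilinear_le hA fun b => ?_
    rw [hβ, norm_mul, norm_mul, norm_e5, mul_one, RCLike.norm_conj, RCLike.norm_conj]
    exact mul_le_one₀ (hu _) (norm_nonneg _) (hu _)

theorem card_image_mulVec_mul_expect_eq_one (A : Matrix (Fin n) (Fin n) (ZMod 5)) :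
    ((Finset.univ.image (A *ᵥ ·)).card : ℝ) * 𝔼 k, (if A *ᵥ k = 0 then (1 : ℝ) else 0) = 1 := by
  have hN : (0 : ℝ) < Fintype.card (F5Vec n) := by exact_mod_cast Fintype.card_pos
  rw [Fintype.expect_eq_sum_div_card, Finset.sum_boole, ← mul_div_assoc, div_eq_one_iff_eq hN.ne']
  have h1 := Finset.card_eq_sum_card_image (A *ᵥ ·) (Finset.univ : Finset (F5Vec n))
  have h2 : ∀ P ∈ Finset.univ.image (A *ᵥ ·), (Finset.univ.filter (A *ᵥ · = P)).card =
      (Finset.univ.filter (A *ᵥ · = 0)).card := by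
    intro P hP
    obtain ⟨x, -, rfl⟩ := Finset.mem_image.1 hP
    refine Finset.card_nbij' (· - x) (· + x) ?_ ?_ ?_ ?_
    · intro y hy
      simpa [Matrix.mulVec_sub, sub_eq_zero] using hy
    · intro y hy
      simpa [Matrix.mulVec_add] using hy
    · intro y _; simp
    · intro y _; simp
  rw [Finset.sum_congr rfl h2, Finset.sum_const, smul_eq_mul, Finset.card_univ] at h1
  exact_mod_cast h1.symm

/-- Where `A a = P` and `A b = Q`, antisymmetry turns the phase into `-P · b + (P - Q) · c`, which
is linear. The twisted average is thus a sum over pairs `(P, Q)` of ordinary convolutions, the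
largest of which yields a Fourier coefficient. -/
theorem exists_structured_coeff (hA : Aᵀ = -A) {u : F5Vec n → ℂ} (hu : ∀ x, ‖u x‖ ≤ 1) :
    ∃ P ξ : F5Vec n, ‖twistedAverage A u‖ ≤ ((Finset.univ.image (A *ᵥ ·)).card : ℝ) ^ 2 *
      ‖𝔼 x, u x * ((if A *ᵥ x = P then 1 else 0) * e5 (ξ ⬝ᵥ x))‖ := by
  set I := Finset.univ.image (A *ᵥ ·) with hI
  have hmem : ∀ a, A *ᵥ a ∈ I := fun a => Finset.mem_image.2 ⟨a, Finset.mem_univ a, rfl⟩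
  set u₁ : F5Vec n → F5Vec n → ℂ := fun P a => u a * if A *ᵥ a = P then 1 else 0 with hu₁
  set u₂ : F5Vec n → F5Vec n → F5Vec n → ℂ := fun P Q b =>
    (starRingEnd ℂ) (u b) * (if A *ᵥ b = Q then 1 else 0) * e5 (-(P ⬝ᵥ b)) with hu₂
  set u₃ : F5Vec n → F5Vec n → F5Vec n → ℂ := fun P Q c =>
    (starRingEnd ℂ) (u c) * e5 ((P - Q) ⬝ᵥ c) with hu₃
  set t : F5Vec n × F5Vec n → ℂ := fun q =>
    𝔼 a, 𝔼 b, 𝔼 c, u₁ q.1 a * u₂ q.1 q.2 b * u₃ q.1 q.2 c * u (b + c - a) with ht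
  have h1 : twistedAverage A u = ∑ q ∈ I ×ˢ I, t q := by
    simp only [ht, ← Finset.expect_sum_comm]
    rw [twistedAverage]
    refine Finset.expect_congr rfl fun a _ => Finset.expect_congr rfl fun b _ =>
      Finset.expect_congr rfl fun c _ => ?_
    rw [Finset.sum_eq_single (A *ᵥ a, A *ᵥ b)]
    · have hph : (b - a) ⬝ᵥ (A *ᵥ (c - a)) =
          -((A *ᵥ a) ⬝ᵥ b) + (A *ᵥ a - A *ᵥ b) ⬝ᵥ c := by
        simp only [Matrix.mulVec_sub, dotProduct_sub, sub_dotProduct,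
          dotProduct_mulVec_self_eq_zero hA]
        rw [dotProduct_mulVec_antisymm hA b c, dotProduct_mulVec_antisymm hA a c,
          dotProduct_comm _ c, dotProduct_comm _ c, dotProduct_comm _ b]
        ring
      rw [hph, e5_add]
      simp only [hu₁, hu₂, hu₃, if_true]
      ring
    · rintro ⟨P, Q⟩ - hPQ
      by_cases hP : A *ᵥ a = P
      · have hQ : A *ᵥ b ≠ Q := fun hQ => hPQ (by rw [hP, hQ])
        simp [hu₂, hQ]
      · simp [hu₁, hP]
    · intro h
      exact absurd (Finset.mem_product.2 ⟨hmem a, hmem b⟩) h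
  obtain ⟨⟨P, Q⟩, -, hmax⟩ := Finset.exists_max_image (I ×ˢ I) (fun q => ‖t q‖)
    ⟨(A *ᵥ 0, A *ᵥ 0), Finset.mem_product.2 ⟨hmem 0, hmem 0⟩⟩
  have hu₂1 : ∀ x, ‖u₂ P Q x‖ ≤ 1 := fun x => by
    by_cases h : A *ᵥ x = Q <;> simp [hu₂, h, hu]
  have hu₃1 : ∀ x, ‖u₃ P Q x‖ ≤ 1 := fun x => by
    simp [hu₃, hu]
  obtain ⟨ξ, hξ⟩ := exists_le_norm_fourierCoeff5 (u₁ := u₁ P) (u₂ := u₂ P Q) (u₃ := u₃ P Q)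
    (u₄ := u)
    hu₂1 hu₃1 hu
  refine ⟨P, ξ, ?_⟩
  have h2 : fourierCoeff5 (u₁ P) ξ =
      𝔼 x, u x * ((if A *ᵥ x = P then 1 else 0) * e5 (ξ ⬝ᵥ x)) := by
    simp only [fourierCoeff5, hu₁, mul_assoc]
  rw [← h2, h1]
  calc ‖∑ q ∈ I ×ˢ I, t q‖ ≤ ∑ q ∈ I ×ˢ I, ‖t q‖ := norm_sum_le _ _
    _ ≤ (I ×ˢ I).card • ‖t (P, Q)‖ := Finset.sum_le_card_nsmul _ _ _ hmax
    _ = (I.card : ℝ) ^ 2 * ‖t (P, Q)‖ := by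
        rw [nsmul_eq_mul, Finset.card_product]; push_cast; ring
    _ ≤ _ := by gcongr

theorem exists_enumeration {α : Type*} (s : Finset α) (hs : s.Nonempty) {K : ℕ}
    (hK : s.card ≤ K) : ∃ r : Fin K → α, ∀ a ∈ s, ∃ j, r j = a := by
  obtain ⟨a₀, ha₀⟩ := hs
  have : Nonempty s := ⟨⟨a₀, ha₀⟩⟩
  obtain ⟨φ⟩ := Function.Embedding.nonempty_of_card_le (α := s) (β := Fin K) (by simpa using hK)
  refine ⟨fun j => (Function.invFun φ j : s), fun a ha => ⟨φ ⟨a, ha⟩, ?_⟩⟩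
  exact congrArg Subtype.val (Function.leftInverse_invFun φ.injective ⟨a, ha⟩)

/-- An inverse theorem for the `U³`-norm: a bounded function with large `U³`-norm correlates with
a bounded function of boundedly many linear forms and one quadratic form. -/
theorem gowersU3_inverse {η : ℝ} (hη : 0 < η) :
    ∃ (K : ℕ) (c : ℝ), 0 < c ∧ ∀ (n : ℕ) (f : F5Vec n → ℝ), (∀ x, |f x| ≤ 1) →
      η ≤ gowersU3Pow f →
      ∃ (r : Fin K → F5Vec n) (S : Matrix (Fin n) (Fin n) (ZMod 5)) (g : F5Vec n → ℂ),
        S.IsSymm ∧ (∀ x, ‖g x‖ ≤ 1) ∧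
        (∀ x y, (∀ j, r j ⬝ᵥ x = r j ⬝ᵥ y) → x ⬝ᵥ (S *ᵥ x) = y ⬝ᵥ (S *ᵥ y) → g x = g y) ∧
        c ≤ ‖𝔼 x, (f x : ℂ) * g x‖ := by
  obtain ⟨c, hc, hcM⟩ := exists_affine_mulDeriv_coeff hη
  -- The image of `A` has `R ≤ 1 / c ^ 4` elements, all used as linear forms, and `ξ` is one more.
  -- The correlation is at least `c ^ 2 / R ^ 2 ≥ c ^ 10`.
  refine ⟨⌊1 / c ^ 4⌋₊ + 1, c ^ 10, by positivity, fun n f hf hηf => ?_⟩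
  obtain ⟨M, b, hM⟩ := hcM n f hf hηf
  set S : Matrix (Fin n) (Fin n) (ZMod 5) := (3 : ZMod 5) • (M + Mᵀ) with hS
  set A : Matrix (Fin n) (Fin n) (ZMod 5) := (3 : ZMod 5) • (M - Mᵀ) with hA
  have hSt : Sᵀ = S := by
    rw [hS, Matrix.transpose_smul, Matrix.transpose_add, Matrix.transpose_transpose, add_comm]
  have hAt : Aᵀ = -A := by
    rw [hA, Matrix.transpose_smul, Matrix.transpose_sub, Matrix.transpose_transpose, ← smul_neg,
      neg_sub]
  have hSA : S + A = M := by
    rw [hS, hA, ← smul_add, add_add_sub_cancel, ← two_smul (ZMod 5), smul_smul]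
    exact one_smul _ M
  set u : F5Vec n → ℂ := fun x => f x * e5 (halfForm S x) with hu
  have hu1 : ∀ x, ‖u x‖ ≤ 1 := fun x => by
    rw [hu, norm_mul, norm_e5, mul_one, Complex.norm_real]; exact hf x
  have hT := expect_coeff_sq_le_twistedAverage (A := A) hf hSt b
  rw [hSA] at hT
  have hT' : c ^ 2 ≤ ‖twistedAverage A u‖ := le_trans (by gcongr) hT
  set R : ℝ := ((Finset.univ.image (A *ᵥ ·)).card : ℝ) with hR
  have hR0 : 0 ≤ R := Nat.cast_nonneg _
  have hRc : R * c ^ 4 ≤ 1 := by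
    rw [← card_image_mulVec_mul_expect_eq_one A]
    refine mul_le_mul_of_nonneg_left ?_ hR0
    calc c ^ 4 = (c ^ 2) ^ 2 := by ring
      _ ≤ ‖twistedAverage A u‖ ^ 2 := by gcongr
      _ ≤ _ := norm_twistedAverage_sq_le hAt hu1
  obtain ⟨P, ξ, hPξ⟩ := exists_structured_coeff hAt hu1
  obtain ⟨r, hr⟩ := exists_enumeration (K := ⌊1 / c ^ 4⌋₊) (Finset.univ.image (A *ᵥ ·))
    (Finset.univ_nonempty.image _)
    (Nat.le_floor (by rw [le_div_iff₀ (by positivity)]; exact hRc))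
  refine ⟨Fin.cons ξ r, S, fun x => e5 (halfForm S x) *
    ((if A *ᵥ x = P then 1 else 0) * e5 (ξ ⬝ᵥ x)), hSt, fun x => ?_, fun x y hxy hq => ?_, ?_⟩
  · rw [norm_mul, norm_mul, norm_e5, norm_e5, one_mul, mul_one]
    split_ifs <;> simp
  · have hξ : ξ ⬝ᵥ x = ξ ⬝ᵥ y := hxy 0
    -- By antisymmetry the `i`-th coordinate of `A x` is minus the product of `x` with the `i`-th
    -- column of `A`, and this column is among the `r j`.
    have hAxy : A *ᵥ x = A *ᵥ y := by
      ext i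
      obtain ⟨j, hj⟩ := hr (A *ᵥ Pi.single i 1) (Finset.mem_image_of_mem _ (Finset.mem_univ _))
      have h1 : r j ⬝ᵥ x = r j ⬝ᵥ y := hxy j.succ
      rw [hj, dotProduct_comm _ x, dotProduct_comm _ y, dotProduct_mulVec_antisymm hAt x,
        dotProduct_mulVec_antisymm hAt y, neg_inj] at h1
      simpa using h1
    beta_reduce
    rw [hξ, hAxy, halfForm, halfForm, hq]
  · have h1 : ∀ x, (f x : ℂ) * (e5 (halfForm S x) *
        ((if A *ᵥ x = P then 1 else 0) * e5 (ξ ⬝ᵥ x))) =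
        u x * ((if A *ᵥ x = P then 1 else 0) * e5 (ξ ⬝ᵥ x)) := fun x => by rw [hu, mul_assoc]
    simp only [h1]
    set m := ‖𝔼 x, u x * ((if A *ᵥ x = P then 1 else 0) * e5 (ξ ⬝ᵥ x))‖ with hm
    have hm0 : 0 ≤ m := norm_nonneg _
    calc c ^ 10 = c ^ 2 * c ^ 8 := by ring
      _ ≤ (R ^ 2 * m) * c ^ 8 := by
          gcongr
          exact hT'.trans hPξ
      _ = (R * c ^ 4) ^ 2 * m := by ring
      _ ≤ 1 ^ 2 * m := by gcongr
      _ = m := by ring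

end Symmetrization

/-! ### Energy increment and iteration. -/

section Decomposition

variable {n : ℕ} {ι : Type}

theorem condAvg_factorOf [Fintype ι] (f : F5Vec n → ℝ)
    (φ : ι → F5Vec n → ZMod 5) (x : F5Vec n) :
    condAvg f (factorOf φ) x = 𝔼 y ∈ Finset.univ.filter (fun y => ∀ i, φ i y = φ i x), f y := by
  unfold condAvg
  congr 1
  ext y
  simp [atomOf_factorOf]

open Classical in
theorem abs_condAvg_le_one {f : F5Vec n → ℝ} (hf : ∀ x, |f x| ≤ 1)
    (B : MeasurableSpace (F5Vec n)) (x : F5Vec n) : |condAvg f B x| ≤ 1 := by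
  unfold condAvg
  refine (Finset.abs_expect_le _ _).trans ?_
  refine Finset.expect_le ⟨x, ?_⟩ fun y _ => hf y
  rw [Finset.mem_filter]
  exact ⟨Finset.mem_univ x, @mem_measurableAtom_self _ B x⟩

/-- The conditional expectation has the same correlation as the function with every function
that is measurable with respect to the factor. -/
theorem expect_condAvg_mul [Fintype ι] (f : F5Vec n → ℝ) {φ : ι → F5Vec n → ZMod 5}
    {g : F5Vec n → ℂ} (hg : ∀ x y, (∀ i, φ i x = φ i y) → g x = g y) :
    𝔼 x, (condAvg f (factorOf φ) x : ℂ) * g x = 𝔼 x, (f x : ℂ) * g x := by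
  classical
  set E : F5Vec n → Finset (F5Vec n) := fun x =>
    Finset.univ.filter (fun y => ∀ i, φ i y = φ i x) with hE
  have hmem : ∀ x y, y ∈ E x ↔ ∀ i, φ i y = φ i x := fun x y => by simp [hE]
  have hEeq : ∀ x y, y ∈ E x → E y = E x := by
    intro x y hy
    ext z
    rw [hmem, hmem]
    rw [hmem] at hy
    simp [hy]
  have hsymm : ∀ x y, y ∈ E x ↔ x ∈ E y := fun x y => by
    rw [hmem, hmem]; exact forall_congr' fun i => eq_comm
  rw [Fintype.expect_eq_sum_div_card, Fintype.expect_eq_sum_div_card]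
  congr 1
  calc ∑ x, (condAvg f (factorOf φ) x : ℂ) * g x
      = ∑ x, ∑ y, if y ∈ E x then (f y : ℂ) * g y / (E y).card else 0 := by
        refine Finset.sum_congr rfl fun x _ => ?_
        rw [condAvg_factorOf, Finset.expect_eq_sum_div_card, Complex.ofReal_div,
          Complex.ofReal_sum, Complex.ofReal_natCast, div_mul_eq_mul_div, Finset.sum_mul,
          Finset.sum_div, ← Finset.sum_filter, Finset.filter_mem_eq_inter, Finset.univ_inter]
        refine Finset.sum_congr rfl fun y hy => ?_
        rw [hEeq x y hy, hg x y fun i => ((hmem x y).1 hy i).symm]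
    _ = ∑ y, ∑ x, if x ∈ E y then (f y : ℂ) * g y / (E y).card else 0 := by
        rw [Finset.sum_comm]
        simp only [fun x y => (hsymm x y)]
    _ = _ := by
        refine Finset.sum_congr rfl fun y _ => ?_
        rw [← Finset.sum_filter, Finset.filter_mem_eq_inter, Finset.univ_inter, Finset.sum_const,
          nsmul_eq_mul]
        have : ((E y).card : ℂ) ≠ 0 := by
          have : 0 < (E y).card := Finset.card_pos.2 ⟨y, (hmem y y).2 fun _ => rfl⟩
          exact_mod_cast this.ne'
        field_simp

theorem expect_condAvg_mul_real [Fintype ι] (f : F5Vec n → ℝ) {φ : ι → F5Vec n → ZMod 5}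
    {g : F5Vec n → ℝ} (hg : ∀ x y, (∀ i, φ i x = φ i y) → g x = g y) :
    𝔼 x, condAvg f (factorOf φ) x * g x = 𝔼 x, f x * g x := by
  have h := expect_condAvg_mul f (φ := φ) (g := fun x => (g x : ℂ)) fun x y hxy => by
    rw [hg x y hxy]
  simp only [← Complex.ofReal_mul, ← ofReal_expect'] at h
  exact_mod_cast h

theorem condAvg_congr [Fintype ι] (f : F5Vec n → ℝ) {φ : ι → F5Vec n → ZMod 5} {x y : F5Vec n}
    (h : ∀ i, φ i x = φ i y) : condAvg f (factorOf φ) x = condAvg f (factorOf φ) y := by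
  classical
  rw [condAvg_factorOf, condAvg_factorOf]
  simp only [h]

/-- The energy increment: if the error term of a conditional expectation correlates with a
function measurable with respect to a finer factor, then the finer factor has larger energy. -/
theorem energy_increment {κ : Type} [Fintype ι] [Fintype κ] (f : F5Vec n → ℝ)
    {φ : ι → F5Vec n → ZMod 5} {ψ : κ → F5Vec n → ZMod 5}
    (hψ : ∀ x y, (∀ k, ψ k x = ψ k y) → ∀ i, φ i x = φ i y)
    {g : F5Vec n → ℂ} (hg : ∀ x y, (∀ k, ψ k x = ψ k y) → g x = g y) (hg1 : ∀ x, ‖g x‖ ≤ 1)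
    {c : ℝ} (hc : 0 ≤ c) (hcorr : c ≤ ‖𝔼 x, ((f x - condAvg f (factorOf φ) x : ℝ) : ℂ) * g x‖) :
    𝔼 x, condAvg f (factorOf φ) x ^ 2 + c ^ 2 ≤ 𝔼 x, condAvg f (factorOf ψ) x ^ 2 := by
  set p := condAvg f (factorOf φ) with hp
  set q := condAvg f (factorOf ψ) with hq
  have h1 : 𝔼 x, q x * p x = 𝔼 x, f x * p x :=
    expect_condAvg_mul_real f fun x y hxy => condAvg_congr f (hψ x y hxy)
  have h2 : 𝔼 x, p x * p x = 𝔼 x, f x * p x :=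
    expect_condAvg_mul_real f fun x y hxy => condAvg_congr f hxy
  -- Pythagoras: `p` is measurable for both factors, so `𝔼 q p = 𝔼 f p = 𝔼 p²`.
  have h3 : 𝔼 x, (q x - p x) ^ 2 = 𝔼 x, q x ^ 2 - 𝔼 x, p x ^ 2 := by
    have : ∀ x, (q x - p x) ^ 2 = q x ^ 2 - 2 * (q x * p x) + p x * p x := fun x => by ring
    simp only [this, Finset.expect_add_distrib, Finset.expect_sub_distrib, ← Finset.mul_expect]
    rw [h1, ← h2]
    simp only [← sq]
    ring
  have h4 : 𝔼 x, ((f x - p x : ℝ) : ℂ) * g x = 𝔼 x, ((q x - p x : ℝ) : ℂ) * g x := by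
    simp only [Complex.ofReal_sub, sub_mul, Finset.expect_sub_distrib]
    rw [expect_condAvg_mul f hg]
  have h5 : c ≤ 𝔼 x, |q x - p x| := by
    rw [h4] at hcorr
    refine hcorr.trans ((RCLike.norm_expect_le (K := ℂ)).trans
      (Finset.expect_le_expect fun x _ => ?_))
    rw [norm_mul, Complex.norm_real]
    exact mul_le_of_le_one_right (norm_nonneg _) (hg1 x)
  have h6 : c ^ 2 ≤ 𝔼 x, (q x - p x) ^ 2 := by
    calc c ^ 2 ≤ (𝔼 x, |q x - p x|) ^ 2 := by gcongr
      _ ≤ 𝔼 x, |q x - p x| ^ 2 := expect_sq_le _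
      _ = _ := by simp only [sq_abs]
  linarith

theorem gowersU3Pow_div_two (f : F5Vec n → ℝ) :
    gowersU3Pow (fun x => f x / 2) = gowersU3Pow f / 256 := by
  unfold gowersU3Pow
  simp only [Finset.expect_div]
  refine Finset.expect_congr rfl fun x _ => Finset.expect_congr rfl fun h₁ _ =>
    Finset.expect_congr rfl fun h₂ _ => Finset.expect_congr rfl fun h₃ _ => ?_
  ring

theorem gowersU3_le_of_pow_le {f : F5Vec n → ℝ} {δ : ℝ} (hδ : 0 ≤ δ)
    (h : gowersU3Pow f ≤ δ ^ 8) : gowersU3 f ≤ δ := by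
  calc gowersU3 f ≤ (δ ^ 8) ^ (1 / 8 : ℝ) :=
        Real.rpow_le_rpow (gowersU3Pow_nonneg f) h (by norm_num)
    _ = δ := by
        rw [← Real.rpow_natCast, ← Real.rpow_mul hδ]
        norm_num

/-- Iterating the energy increment. -/
theorem exists_refinement_of_energy_ge {δ c : ℝ} (hδ : 0 < δ) (hc : 0 < c) {K : ℕ}
    (hinv : ∀ f : F5Vec n → ℝ, (∀ x, |f x| ≤ 1) → δ ^ 8 / 256 ≤ gowersU3Pow f →
      ∃ (r : Fin K → F5Vec n) (S : Matrix (Fin n) (Fin n) (ZMod 5)) (g : F5Vec n → ℂ),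
        S.IsSymm ∧ (∀ x, ‖g x‖ ≤ 1) ∧
        (∀ x y, (∀ j, r j ⬝ᵥ x = r j ⬝ᵥ y) → x ⬝ᵥ (S *ᵥ x) = y ⬝ᵥ (S *ᵥ y) → g x = g y) ∧
        c ≤ ‖𝔼 x, (f x : ℂ) * g x‖)
    {f : F5Vec n → ℝ} (hf : ∀ x, |f x| ≤ 1) (m : ℕ) :
    ∀ (e₁ e₂ : ℕ) (r : Fin e₁ → F5Vec n) (M : Fin e₂ → Matrix (Fin n) (Fin n) (ZMod 5)),
      (∀ j, (M j).IsSymm) → 1 - m * c ^ 2 ≤ 𝔼 x, condAvg f (linQuadFactor r M) x ^ 2 →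
      ∃ (e₁' e₂' : ℕ) (r' : Fin e₁' → F5Vec n)
        (M' : Fin e₂' → Matrix (Fin n) (Fin n) (ZMod 5)),
        e₁' ≤ e₁ + m * K ∧ e₂' ≤ e₂ + m ∧ (∀ j, (M' j).IsSymm) ∧
        (∀ x y, (∀ j, r' j ⬝ᵥ x = r' j ⬝ᵥ y) → ∀ j, r j ⬝ᵥ x = r j ⬝ᵥ y) ∧
        (∀ x y, (∀ j, x ⬝ᵥ (M' j *ᵥ x) = y ⬝ᵥ (M' j *ᵥ y)) →
          ∀ j, x ⬝ᵥ (M j *ᵥ x) = y ⬝ᵥ (M j *ᵥ y)) ∧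
        gowersU3 (fun x => f x - condAvg f (linQuadFactor r' M') x) ≤ δ := by
  have step : ∀ (e₁ e₂ : ℕ) (r : Fin e₁ → F5Vec n)
      (M : Fin e₂ → Matrix (Fin n) (Fin n) (ZMod 5)), (∀ j, (M j).IsSymm) →
      ¬ gowersU3 (fun x => f x - condAvg f (linQuadFactor r M) x) ≤ δ →
      ∃ (r' : Fin (e₁ + K) → F5Vec n) (M' : Fin (e₂ + 1) → Matrix (Fin n) (Fin n) (ZMod 5)),
        (∀ j, (M' j).IsSymm) ∧
        (∀ x y, (∀ j, r' j ⬝ᵥ x = r' j ⬝ᵥ y) → ∀ j, r j ⬝ᵥ x = r j ⬝ᵥ y) ∧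
        (∀ x y, (∀ j, x ⬝ᵥ (M' j *ᵥ x) = y ⬝ᵥ (M' j *ᵥ y)) →
          ∀ j, x ⬝ᵥ (M j *ᵥ x) = y ⬝ᵥ (M j *ᵥ y)) ∧
        𝔼 x, condAvg f (linQuadFactor r M) x ^ 2 + c ^ 2 ≤
          𝔼 x, condAvg f (linQuadFactor r' M') x ^ 2 := by
    intro e₁ e₂ r M hM hU
    -- The error term is only bounded by `2`, so it is halved before the inverse theorem applies;
    -- the eighth power then costs `2 ^ 8 = 256`.
    have hpow : δ ^ 8 / 256 ≤
        gowersU3Pow (fun x => (f x - condAvg f (linQuadFactor r M) x) / 2) := by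
      rw [gowersU3Pow_div_two]
      by_contra hlt
      exact hU (gowersU3_le_of_pow_le hδ.le (by linarith))
    obtain ⟨s, S, g, hS, hg1, hg, hcorr⟩ := hinv _ (fun x => by
      have h1 := hf x
      have h2 := abs_condAvg_le_one hf (linQuadFactor r M) x
      rw [abs_le] at *
      constructor <;> linarith) hpow
    have hr : ∀ x y, (∀ j, Fin.append r s j ⬝ᵥ x = Fin.append r s j ⬝ᵥ y) →
        (∀ j, r j ⬝ᵥ x = r j ⬝ᵥ y) ∧ ∀ j, s j ⬝ᵥ x = s j ⬝ᵥ y := fun x y h =>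
      ⟨fun j => by simpa using h (Fin.castAdd K j), fun j => by simpa using h (Fin.natAdd e₁ j)⟩
    have hMS : ∀ x y : F5Vec n, (∀ j, x ⬝ᵥ ((Fin.snoc M S : Fin (e₂ + 1) → _) j *ᵥ x) =
        y ⬝ᵥ ((Fin.snoc M S : Fin (e₂ + 1) → _) j *ᵥ y)) →
        (∀ j, x ⬝ᵥ (M j *ᵥ x) = y ⬝ᵥ (M j *ᵥ y)) ∧ x ⬝ᵥ (S *ᵥ x) = y ⬝ᵥ (S *ᵥ y) := fun x y h =>
      ⟨fun j => by simpa using h j.castSucc, by simpa using h (Fin.last e₂)⟩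
    refine ⟨Fin.append r s, Fin.snoc M S, fun j => ?_, fun x y h => (hr x y h).1,
      fun x y h => (hMS x y h).1, ?_⟩
    · refine Fin.lastCases ?_ (fun j => ?_) j
      · simpa using hS
      · simpa using hM j
    · refine energy_increment f (g := g) (fun x y h => ?_) (fun x y h => ?_) hg1 hc.le ?_
      · have h1 := hr x y fun j => h (Sum.inl j)
        have h2 := hMS x y fun j => h (Sum.inr j)
        rintro (j | j)
        · exact h1.1 j
        · exact h2.1 j
      · exact hg x y (hr x y fun j => h (Sum.inl j)).2 (hMS x y fun j => h (Sum.inr j)).2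
      · have h1 : 𝔼 x, (((f x - condAvg f (linQuadFactor r M) x) / 2 : ℝ) : ℂ) * g x =
            (𝔼 x, ((f x - condAvg f (linQuadFactor r M) x : ℝ) : ℂ) * g x) / 2 := by
          rw [Finset.expect_div]
          refine Finset.expect_congr rfl fun x _ => ?_
          push_cast
          ring
        rw [h1, norm_div, Complex.norm_ofNat] at hcorr
        have := norm_nonneg (𝔼 x, ((f x - condAvg f (linQuadFactor r M) x : ℝ) : ℂ) * g x)
        change c ≤ ‖𝔼 x, ((f x - condAvg f (linQuadFactor r M) x : ℝ) : ℂ) * g x‖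
        linarith
  have hle : ∀ B : MeasurableSpace (F5Vec n), 𝔼 x, condAvg f B x ^ 2 ≤ 1 := fun B =>
    Finset.expect_le Finset.univ_nonempty fun x _ =>
      (sq_le_one_iff_abs_le_one _).2 (abs_condAvg_le_one hf B x)
  -- Here `m * c ^ 2` bounds the energy still to be gained. At `m = 0` the energy is already at
  -- least `1`, so a further increment is impossible.
  induction m with
  | zero =>
    intro e₁ e₂ r M hM hen
    by_cases hU : gowersU3 (fun x => f x - condAvg f (linQuadFactor r M) x) ≤ δ
    · exact ⟨e₁, e₂, r, M, by simp, by simp, hM, fun _ _ h => h, fun _ _ h => h, hU⟩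
    · obtain ⟨r', M', -, -, -, h⟩ := step e₁ e₂ r M hM hU
      have h1 := hle (linQuadFactor r' M')
      have h2 : 0 < c ^ 2 := by positivity
      norm_num at hen
      linarith
  | succ m ih =>
    intro e₁ e₂ r M hM hen
    by_cases hU : gowersU3 (fun x => f x - condAvg f (linQuadFactor r M) x) ≤ δ
    · exact ⟨e₁, e₂, r, M, by simp, by simp, hM, fun _ _ h => h, fun _ _ h => h, hU⟩
    · obtain ⟨r', M', hM', h1, h2, h⟩ := step e₁ e₂ r M hM hU
      push_cast at hen
      obtain ⟨e₁'', e₂'', r'', M'', he₁, he₂, hM'', h1', h2', hU'⟩ :=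
        ih _ _ r' M' hM' (by linarith)
      exact ⟨e₁'', e₂'', r'', M'', by rw [add_mul]; omega, by omega, hM'',
        fun x y h => h1 x y (h1' x y h), fun x y h => h2 x y (h2' x y h), hU'⟩

theorem refinesFactor_factorOf {κ : Type} {φ : ι → F5Vec n → ZMod 5} {ψ : κ → F5Vec n → ZMod 5}
    (hψ : ∀ x y, (∀ k, ψ k x = ψ k y) → ∀ i, φ i x = φ i y) :
    RefinesFactor (factorOf ψ) (factorOf φ) := by
  intro x
  refine ⟨x, ?_⟩
  rw [atomOf_factorOf, atomOf_factorOf]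
  exact fun y hy => hψ y x hy

end Decomposition

theorem mainTheorem5 (δ : ℝ) (hδ : 0 < δ) :
    ∃ C : ℕ, ∀ (n d₁ d₂ : ℕ) (B₁₀ B₂₀ : MeasurableSpace (F5Vec n)),
      IsQuadraticFactorLE B₁₀ B₂₀ d₁ d₂ →
      ∀ f : F5Vec n → ℝ, (∀ x, f x ∈ Set.Icc (-1 : ℝ) 1) →
        ∃ B₁ B₂ : MeasurableSpace (F5Vec n),
          IsQuadraticFactorLE B₁ B₂ (d₁ + C) (d₂ + C) ∧
          RefinesFactor B₁ B₁₀ ∧ RefinesFactor B₂ B₂₀ ∧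
          ∃ f₁ f₂ : F5Vec n → ℝ,
            f = f₁ + f₂ ∧ f₁ = condAvg f B₂ ∧ gowersU3 f₂ ≤ δ := by
  obtain ⟨K, c, hc, hinv⟩ := gowersU3_inverse (η := δ ^ 8 / 256) (by positivity)
  obtain ⟨m, hm⟩ := exists_nat_ge (1 / c ^ 2)
  have hm' : 1 - m * c ^ 2 ≤ 0 := by
    rw [div_le_iff₀ (by positivity)] at hm
    linarith
  -- At most `m` rounds add `K` linear forms and one quadratic form each; the sum bounds both
  -- increases. By `hm'` the starting energy condition is just nonnegativity.
  refine ⟨m * K + m, fun n d₁ d₂ B₁₀ B₂₀ hB f hf => ?_⟩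
  obtain ⟨e₁, e₂, he₁, he₂, r, M, hM, rfl, rfl⟩ := hB
  obtain ⟨e₁', e₂', r', M', he₁', he₂', hM', h1, h2, hU⟩ :=
    exists_refinement_of_energy_ge hδ hc (hinv n) (fun x => abs_le.2 (hf x)) m e₁ e₂ r M hM
      (hm'.trans (Finset.expect_nonneg fun _ _ => sq_nonneg _))
  refine ⟨linearFactor r', linQuadFactor r' M',
    ⟨e₁', e₂', by omega, by omega, r', M', hM', rfl, rfl⟩,
    refinesFactor_factorOf h1, refinesFactor_factorOf fun x y h => ?_,
    condAvg f (linQuadFactor r' M'), fun x => f x - condAvg f (linQuadFactor r' M') x, ?_, rfl, hU⟩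
  · rintro (j | j)
    · exact h1 x y (fun j => h (Sum.inl j)) j
    · exact h2 x y (fun j => h (Sum.inr j)) j
  · ext x
    simp
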